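/- Conventions. A labeled Delone set $T$ of $\mathbb R^d$ is the graph of a map from a uniformly discrete and relatively dense subset of $\mathbb R^d$ (its set of points) to a compact metric space of labels. Labeled Delone sets with labels in a fixed space carry the vague topology: two of them are close if, on a large ball around $0$, their points are in bijection with corresponding points and labels close. Write $T-x$ for the translate of $T$ by $-x$. A tiling space $\Omega$ is the hull $\overline{\{T-x : x\in\mathbb R^d\}}$ of a labeled Delone set, assumed minimal (every translation orbit is dense in $\Omega$). It is aperiodic if $T-x=T$ implies $x=0$ for $T\in\Omega$; it is uniquely ergodic if it has exactly one translation-invariant Borel probability measure $\mu$; it has finite local complexity (FLC) if for every $R$ there are, up to translation, only finitely many patches of radius $R$ in the elements of $\Omega$. A function $s$ on $\Omega$ is strongly pattern-equivariant (PE) if for some $R$ the value $s(T)$ depends only on the patch $T\cap B(0,R)$. A weak cocycle is a continuous map $\alpha:\Omega\times\mathbb R^d\to\mathbb R^d$ with $\alpha(T,x)+\alpha(T-x,y)=\alpha(T,x+y)$; it is a strong cocycle if $T\mapsto\alpha(T,v)$ is strongly PE for every $v$. The coboundary of a continuous $s:\Omega\to\mathbb R^d$ is $(T,v)\mapsto s(T-v)-s(T)$.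 $H^1_w(\Omega;\mathbb R^d)$ is the group of weak cocycles modulo coboundaries of continuous functions, and $H^1_s(\Omega;\mathbb R^d)$ is the group of strong cocycles modulo coboundaries of continuous strongly PE functions. The Ruelle–Sullivan map sends the class $[\alpha]$ to the $d\times d$ matrix $C_\mu[\alpha]$ of the linear map $v\mapsto\int_\Omega\alpha(T,v)\,d\mu(T)$; on $H^1_s$ it is composed with the natural map $H^1_s\to H^1_w$. A map $h:\Omega\to\Omega'$ of tiling spaces is the shape deformation induced by a cocycle $\alpha$ if, for all $T\in\Omega$ and $x\in\mathbb R^d$, the map $\alpha(T,\cdot)$ is a homeomorphism of $\mathbb R^d$ carrying the set of points of $T$ onto the set of points of $h(T)$, and $h(T-x)=h(T)-\alpha(T,x)$. Theorem. Let $\Omega$ be a uniquely ergodic tiling space with invariant probability measure $\mu$. (1) Let $c\in H^1_w(\Omega;\mathbb R^d)$ be such that $C_\mu(c)$ is invertible. Then there are a weak cocycle $\alpha_0$ representing $c$, a tiling space $\Omega'$ and a homeomorphism $h_{\alpha_0}:\Omega\to\Omega'$ that is a shape deformation induced by $\alpha_0$. (2) If moreover $\Omega$ has FLC and $c\in H^1_s(\Omega;\mathbb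 R^d)$ is such that $C_\mu(c)$ is invertible, then there are a strong cocycle $\alpha_0$ representing $c$ in $H^1_s(\Omega;\mathbb R^d)$, an FLC tiling space $\Omega'$ and a homeomorphism $h_{\alpha_0}:\Omega\to\Omega'$ that is a shape deformation induced by $\alpha_0$. In both cases, $\Omega'$ is aperiodic if $\Omega$ is. -/

import Mathlib

open scoped Topology CompactlySupported
open MeasureTheory

universe u

/-- A labeled Delone set of `ℝ^d` with labels in `X`: the graph, as a set of pairs
`(point, label)`, of a map from a uniformly discrete and relatively dense set of points to `X`.
(Uniform discreteness is required of distinct pairs, so that no point carries two labels.) -/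
@[ext]
structure LabeledDelone (d : ℕ) (X : Type u) where
  carrier : Set (EuclideanSpace ℝ (Fin d) × X)
  uniformlyDiscrete : ∃ r : ℝ, 0 < r ∧
    ∀ p ∈ carrier, ∀ q ∈ carrier, p ≠ q → r ≤ dist p.1 q.1
  relativelyDense : ∃ R : ℝ, 0 < R ∧
    ∀ x : EuclideanSpace ℝ (Fin d), ∃ p ∈ carrier, dist p.1 x ≤ R

namespace LabeledDelone

variable {d : ℕ} {X : Type u}

/-- The underlying Delone set, without labels. -/
def points (T : LabeledDelone d X) : Set (EuclideanSpace ℝ (Fin d)) := Prod.fst '' T.carrier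

/-- The translate `T - x`. -/
def translate (T : LabeledDelone d X) (x : EuclideanSpace ℝ (Fin d)) : LabeledDelone d X where
  carrier := (fun p => (p.1 - x, p.2)) '' T.carrier
  uniformlyDiscrete := by
    obtain ⟨r, hr, h⟩ := T.uniformlyDiscrete
    refine ⟨r, hr, ?_⟩
    rintro _ ⟨p, hp, rfl⟩ _ ⟨q, hq, rfl⟩ hpq
    simpa using h p hp q hq (by rintro rfl; exact hpq rfl)
  relativelyDense := by
    obtain ⟨R, hR, h⟩ := T.relativelyDense
    refine ⟨R, hR, fun y => ?_⟩
    obtain ⟨p, hp, h'⟩ := h (y + x)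
    refine ⟨_, ⟨p, hp, rfl⟩, ?_⟩
    rw [dist_eq_norm] at h' ⊢
    convert h' using 2
    simp only
    abel

/-- The patch `T ∩ B(0, R)`. -/
def patch (T : LabeledDelone d X) (R : ℝ) : Set (EuclideanSpace ℝ (Fin d) × X) :=
  {p ∈ T.carrier | ‖p.1‖ < R}

theorem translate_translate (T : LabeledDelone d X) (x y : EuclideanSpace ℝ (Fin d)) :
    (T.translate x).translate y = T.translate (x + y) := by
  refine LabeledDelone.ext ?_
  simp only [translate, Set.image_image, sub_sub]

variable [MetricSpace X]

/-- The integral of a test function against the sum of the Dirac masses at the labeled points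
of `T`; for each `T` and `f` only finitely many terms are nonzero. -/
noncomputable def eval (f : C_c(EuclideanSpace ℝ (Fin d) × X, ℝ)) (T : LabeledDelone d X) : ℝ :=
  ∑ᶠ p ∈ T.carrier, f p

/-- The vague topology on labeled Delone sets: `T` and `T'` are close if, on a large ball around
the origin, their labeled points are in one-to-one correspondence, with corresponding points
and labels close to each other. -/
noncomputable instance : TopologicalSpace (LabeledDelone d X) :=
  ⨅ f : C_c(EuclideanSpace ℝ (Fin d) × X, ℝ), TopologicalSpace.induced (eval f) inferInstance

noncomputable instance : MeasurableSpace (LabeledDelone d X) := borel _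

instance : BorelSpace (LabeledDelone d X) := ⟨rfl⟩

/-- The hull of `T`: the closure of its translation orbit. -/
def hull (T : LabeledDelone d X) : Set (LabeledDelone d X) :=
  closure (Set.range T.translate)

theorem continuous_eval (f : C_c(EuclideanSpace ℝ (Fin d) × X, ℝ)) :
    Continuous (eval f : LabeledDelone d X → ℝ) :=
  continuous_iInf_dom (i := f) continuous_induced_dom

theorem le_nhds_iff (l : Filter (LabeledDelone d X)) (T : LabeledDelone d X) :
    l ≤ 𝓝 T ↔ ∀ f : C_c(EuclideanSpace ℝ (Fin d) × X, ℝ),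
      Filter.Tendsto (eval f) l (𝓝 (eval f T)) := by
  rw [nhds_iInf, le_iInf_iff]
  refine forall_congr' fun f => ?_
  rw [nhds_induced, Filter.tendsto_iff_comap]

theorem continuous_translate (x : EuclideanSpace ℝ (Fin d)) :
    Continuous (fun T : LabeledDelone d X => T.translate x) := by
  refine continuous_iInf_rng.2 fun f => continuous_induced_rng.2 ?_
  let φ : EuclideanSpace ℝ (Fin d) × X ≃ₜ EuclideanSpace ℝ (Fin d) × X :=
    (Homeomorph.subRight x).prodCongr (Homeomorph.refl X)
  let g : C_c(EuclideanSpace ℝ (Fin d) × X, ℝ) :=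
    ⟨⟨f ∘ φ, f.continuous.comp φ.continuous⟩, f.hasCompactSupport.comp_homeomorph φ⟩
  convert continuous_eval g using 1
  ext T
  exact finsum_mem_image (φ.injective.injOn)

theorem translate_mem_hull {T S : LabeledDelone d X} (hS : S ∈ T.hull)
    (x : EuclideanSpace ℝ (Fin d)) : S.translate x ∈ T.hull := by
  refine map_mem_closure (f := fun T : LabeledDelone d X => T.translate x)
    (continuous_translate x) hS ?_
  rintro _ ⟨y, rfl⟩
  exact ⟨y + x, (T.translate_translate y x).symm⟩

theorem exists_card_le {K : Set (EuclideanSpace ℝ (Fin d) × X)} (hK : IsCompact K) {r : ℝ}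
    (hr : 0 < r) : ∃ N : ℕ, ∀ S : Set (EuclideanSpace ℝ (Fin d) × X),
      (∀ p ∈ S, ∀ q ∈ S, p ≠ q → r ≤ dist p.1 q.1) → (S ∩ K).Finite ∧ (S ∩ K).ncard ≤ N := by
  obtain ⟨t, -, htf, ht⟩ := (hK.image continuous_fst).finite_cover_balls (half_pos hr)
  have h : ∀ p ∈ K, ∃ c ∈ t, p.1 ∈ Metric.ball c (r / 2) := fun p hp => by
    simpa using ht ⟨p, hp, rfl⟩
  choose! c hct hc using h
  refine ⟨t.ncard, fun S hS => ?_⟩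
  have hmaps : Set.MapsTo c (S ∩ K) t := fun p hp => hct p hp.2
  have hinj : Set.InjOn c (S ∩ K) := by
    intro p hp q hq hpq
    by_contra hne
    have h1 := hS p hp.1 q hq.1 hne
    have h2 := hc p hp.2
    have h3 := hc q hq.2
    rw [← hpq] at h3
    rw [Metric.mem_ball] at h2 h3
    linarith [dist_triangle_right p.1 q.1 (c p)]
  exact ⟨Set.Finite.of_injOn hmaps hinj htf,
    Set.ncard_le_ncard_of_injOn c hmaps hinj htf⟩

theorem finite_inter (T : LabeledDelone d X) {K : Set (EuclideanSpace ℝ (Fin d) × X)}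
    (hK : IsCompact K) : (T.carrier ∩ K).Finite := by
  obtain ⟨r, hr, h⟩ := T.uniformlyDiscrete
  obtain ⟨N, hN⟩ := exists_card_le hK hr
  exact (hN _ h).1

theorem eval_eq_sum (f : C_c(EuclideanSpace ℝ (Fin d) × X, ℝ)) (T : LabeledDelone d X)
    (F : Finset (EuclideanSpace ℝ (Fin d) × X)) (hF : ∀ p ∈ F, p ∈ T.carrier)
    (hF' : ∀ p ∈ T.carrier, f p ≠ 0 → p ∈ F) : eval f T = ∑ p ∈ F, f p := by
  refine finsum_mem_eq_sum_of_inter_support_eq _ ?_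
  ext p
  simp only [Set.mem_inter_iff, Function.mem_support, Finset.mem_coe]
  exact ⟨fun h => ⟨hF' p h.1 h.2, h.2⟩, fun h => ⟨hF p h.1, h.2⟩⟩

variable [CompactSpace X]

instance : T2Space (LabeledDelone d X) := by
  have key : ∀ T T' : LabeledDelone d X, (∃ p ∈ T.carrier, p ∉ T'.carrier) →
      ∃ f : C_c(EuclideanSpace ℝ (Fin d) × X, ℝ), eval f T ≠ eval f T' := by
    rintro T T' ⟨p, hp, hp'⟩
    obtain ⟨K, hK, hKp⟩ := exists_compact_mem_nhds p
    have hfin := T'.finite_inter hK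
    obtain ⟨f, hf1, hf0, hfc, hf⟩ := exists_continuous_one_zero_of_isCompact
      (isCompact_singleton (x := p))
      (isOpen_interior.sdiff hfin.isClosed : IsOpen (interior K \ (T'.carrier ∩ K))).isClosed_compl
      (by
        rw [Set.disjoint_singleton_left]
        exact fun h => h ⟨mem_interior_iff_mem_nhds.2 hKp, fun h => hp' h.1⟩)
    refine ⟨⟨f, hfc⟩, ?_⟩
    have h0 : eval ⟨f, hfc⟩ T' = 0 := by
      rw [eval_eq_sum ⟨f, hfc⟩ T' ∅ (by simp)]
      · simp
      · intro q hq hfq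
        refine absurd (hf0 fun h => h.2 ⟨hq, interior_subset h.1⟩) hfq
    have h1 : 1 ≤ eval ⟨f, hfc⟩ T := by
      rw [eval_eq_sum ⟨f, hfc⟩ T (T.finite_inter hfc).toFinset (by simp +contextual)]
      · have : f p = 1 := hf1 rfl
        rw [← this]
        refine Finset.single_le_sum (f := fun q => f q) (fun q _ => (hf q).1) ?_
        simp only [Set.Finite.mem_toFinset]
        exact ⟨hp, subset_tsupport _ (by simp [this])⟩
      · intro q hq hfq
        simp only [Set.Finite.mem_toFinset]
        exact ⟨hq, subset_tsupport _ hfq⟩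
    linarith
  refine ⟨fun T T' hne => ?_⟩
  have : ∃ f : C_c(EuclideanSpace ℝ (Fin d) × X, ℝ), eval f T ≠ eval f T' := by
    by_cases h : T.carrier ⊆ T'.carrier
    · by_cases h' : T'.carrier ⊆ T.carrier
      · exact absurd (LabeledDelone.ext (h.antisymm h')) hne
      · obtain ⟨f, hf⟩ := key T' T (Set.not_subset.1 h')
        exact ⟨f, hf.symm⟩
    · exact key T T' (Set.not_subset.1 h)
  obtain ⟨f, hf⟩ := this
  exact separated_by_continuous (continuous_eval f) hf

theorem isCompact_setOf (r R : ℝ) (hr : 0 < r) (hR : 0 < R) :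
    IsCompact {T : LabeledDelone d X |
      (∀ p ∈ T.carrier, ∀ q ∈ T.carrier, p ≠ q → r ≤ dist p.1 q.1) ∧
      ∀ x : EuclideanSpace ℝ (Fin d), ∃ p ∈ T.carrier, dist p.1 x ≤ R} := by
  rw [isCompact_iff_ultrafilter_le_nhds']
  intro U hU
  let S : Set (EuclideanSpace ℝ (Fin d) × X) :=
    {p | ∀ V ∈ 𝓝 p, ∀ᶠ T in (U : Filter (LabeledDelone d X)), (T.carrier ∩ V).Nonempty}
  have hlim : ∀ (g : LabeledDelone d X → EuclideanSpace ℝ (Fin d) × X)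
      (K : Set (EuclideanSpace ℝ (Fin d) × X)), IsCompact K →
      (∀ᶠ T in (U : Filter (LabeledDelone d X)), g T ∈ T.carrier ∩ K) →
      ∃ p ∈ K, p ∈ S ∧ Filter.Tendsto g U (𝓝 p) := by
    intro g K hK hg
    obtain ⟨p, hpK, hp⟩ := isCompact_iff_ultrafilter_le_nhds'.1 hK (U.map g)
      (show ∀ᶠ T in (U : Filter (LabeledDelone d X)), g T ∈ K from hg.mono fun T hT => hT.2)
    refine ⟨p, hpK, fun V hV => ?_, hp⟩
    filter_upwards [hg, (show Filter.Tendsto g U (𝓝 p) from hp) hV] with T hT hT'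
    exact ⟨g T, hT.1, hT'⟩
  have hsep : ∀ p ∈ S, ∀ q ∈ S, p ≠ q → r ≤ dist p.1 q.1 := by
    intro p hp q hq hpq
    refine le_of_forall_pos_le_add fun ε hε => ?_
    obtain ⟨A, B, hA, hB, hpA, hqB, hAB⟩ := t2_separation hpq
    have h1 := hp _ (Filter.inter_mem (hA.mem_nhds hpA) (Metric.ball_mem_nhds p (half_pos hε)))
    have h2 := hq _ (Filter.inter_mem (hB.mem_nhds hqB) (Metric.ball_mem_nhds q (half_pos hε)))
    obtain ⟨T, ⟨a, haT, haA, ha⟩, ⟨b, hbT, hbB, hb⟩, hT⟩ := (h1.and (h2.and hU)).exists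
    have h3 := hT.1 a haT b hbT (fun h => Set.disjoint_left.1 hAB haA (h ▸ hbB))
    rw [Metric.mem_ball, Prod.dist_eq, max_lt_iff] at ha hb
    have h4 := dist_triangle4 a.1 p.1 q.1 b.1
    rw [dist_comm q.1 b.1] at h4
    linarith [ha.1, hb.1]
  have hdense : ∀ x : EuclideanSpace ℝ (Fin d), ∃ p ∈ S, dist p.1 x ≤ R := by
    intro x
    have h : ∀ T : LabeledDelone d X, ∃ p,
        (∀ x : EuclideanSpace ℝ (Fin d), ∃ p ∈ T.carrier, dist p.1 x ≤ R) →
          p ∈ T.carrier ∧ dist p.1 x ≤ R := by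
      intro T
      by_cases hT : ∀ x : EuclideanSpace ℝ (Fin d), ∃ p ∈ T.carrier, dist p.1 x ≤ R
      · obtain ⟨p, hp⟩ := hT x
        exact ⟨p, fun _ => hp⟩
      · obtain ⟨_, -, h⟩ := T.relativelyDense
        obtain ⟨p, -⟩ := h x
        exact ⟨p, fun h => absurd h hT⟩
    choose g hg using h
    obtain ⟨p, hpK, hpS, -⟩ := hlim g (Metric.closedBall x R ×ˢ Set.univ)
      ((isCompact_closedBall x R).prod isCompact_univ) (by
        filter_upwards [hU] with T hT
        exact ⟨(hg T hT.2).1, (hg T hT.2).2, trivial⟩)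
    exact ⟨p, hpS, hpK.1⟩
  refine ⟨⟨S, ⟨r, hr, hsep⟩, ⟨R, hR, hdense⟩⟩, ⟨hsep, hdense⟩, (le_nhds_iff _ _).2 fun f => ?_⟩
  have hK : IsCompact (tsupport f) := f.hasCompactSupport
  obtain ⟨N, hN⟩ := exists_card_le hK hr
  obtain ⟨n, hn⟩ : ∃ n ∈ Set.Iic N, ∀ᶠ T in (U : Filter (LabeledDelone d X)),
      (T.carrier ∩ tsupport f).ncard = n := by
    have := (Ultrafilter.eventually_exists_mem_iff (f := U) (his := Set.finite_Iic N)
      (P := fun n (T : LabeledDelone d X) => (T.carrier ∩ tsupport f).ncard = n)).1 (by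
        filter_upwards [hU] with T hT
        exact ⟨_, (hN _ hT.1).2, rfl⟩)
    exact this
  have henum : ∀ T : LabeledDelone d X, ∃ e : Fin n → EuclideanSpace ℝ (Fin d) × X,
      (T.carrier ∩ tsupport f).ncard = n →
        Function.Injective e ∧ Set.range e = T.carrier ∩ tsupport f := by
    intro T
    by_cases h : (T.carrier ∩ tsupport f).ncard = n
    · have hfin := T.finite_inter hK
      have hcard : hfin.toFinset.card = n := by
        rw [← h, Set.ncard_eq_toFinset_card _ hfin]
      refine ⟨fun i => (hfin.toFinset.equivFinOfCardEq hcard).symm i, fun _ => ⟨?_, ?_⟩⟩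
      · exact Subtype.val_injective.comp (Equiv.injective _)
      · ext p
        simp only [Set.mem_range]
        constructor
        · rintro ⟨i, rfl⟩
          exact hfin.mem_toFinset.1 ((hfin.toFinset.equivFinOfCardEq hcard).symm i).2
        · intro hp
          exact ⟨hfin.toFinset.equivFinOfCardEq hcard ⟨p, by simpa using hp⟩, by simp⟩
    · obtain ⟨_, -, h'⟩ := T.relativelyDense
      obtain ⟨p, -⟩ := h' 0
      exact ⟨fun _ => p, fun h' => absurd h' h⟩
  choose e he using henum
  have hq : ∀ i : Fin n, ∃ p ∈ tsupport f, p ∈ S ∧ Filter.Tendsto (fun T => e T i) U (𝓝 p) := by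
    intro i
    refine hlim _ _ hK ?_
    filter_upwards [hn.2] with T hT
    rw [← (he T hT).2]
    exact ⟨i, rfl⟩
  choose q hqK hqS hqlim using hq
  have hqinj : Function.Injective q := by
    intro i j hij
    by_contra hne
    have h1 : Filter.Tendsto (fun T => dist (e T i).1 (e T j).1) U (𝓝 (dist (q i).1 (q j).1)) :=
      ((continuous_fst.tendsto _).comp (hqlim i)).dist ((continuous_fst.tendsto _).comp (hqlim j))
    have h2 : r ≤ dist (q i).1 (q j).1 := by
      refine ge_of_tendsto h1 ?_
      filter_upwards [hU, hn.2] with T hT hT'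
      have hr := (he T hT').2
      refine hT.1 _ ?_ _ ?_ ((he T hT').1.ne hne)
      · exact (hr.subset ⟨i, rfl⟩).1
      · exact (hr.subset ⟨j, rfl⟩).1
    rw [hij, dist_self] at h2
    linarith
  classical
  have hS : eval f ⟨S, ⟨r, hr, hsep⟩, ⟨R, hR, hdense⟩⟩ = ∑ i, f (q i) := by
    rw [eval_eq_sum f _ (Finset.univ.image q) (by simpa using hqS),
      Finset.sum_image hqinj.injOn]
    intro p hp hfp
    by_contra hpq
    have hpq' : ∀ i, q i ≠ p := by simpa using hpq
    have hV : ∃ V ∈ 𝓝 p, ∀ i, ∀ᶠ T in (U : Filter (LabeledDelone d X)), e T i ∉ V := by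
      have : ∀ i, ∃ V ∈ 𝓝 p, ∀ᶠ T in (U : Filter (LabeledDelone d X)), e T i ∉ V := by
        intro i
        obtain ⟨A, B, hA, hB, hqA, hpB, hAB⟩ := t2_separation (hpq' i)
        refine ⟨B, hB.mem_nhds hpB, ?_⟩
        filter_upwards [hqlim i (hA.mem_nhds hqA)] with T hT
        exact fun h => Set.disjoint_left.1 hAB hT h
      choose V hV hV' using this
      refine ⟨⋂ i, V i, Filter.iInter_mem.2 hV, fun i => ?_⟩
      filter_upwards [hV' i] with T hT h
      exact hT (Set.mem_iInter.1 h i)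
    obtain ⟨V, hV, hV'⟩ := hV
    have h1 := hp _ (Filter.inter_mem hV (f.continuous.isOpen_support.mem_nhds hfp))
    obtain ⟨T, ⟨a, haT, haV, haf⟩, hT, hT'⟩ :=
      (h1.and ((Filter.eventually_all.2 hV').and hn.2)).exists
    obtain ⟨i, rfl⟩ := (he T hT').2.superset ⟨haT, subset_tsupport _ haf⟩
    exact hT i haV
  rw [hS]
  have hsum : Filter.Tendsto (fun T => ∑ i, f (e T i)) U (𝓝 (∑ i, f (q i))) :=
    tendsto_finsetSum _ fun i _ => (f.continuous.tendsto _).comp (hqlim i)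
  refine hsum.congr' ?_
  filter_upwards [hn.2] with T hT
  obtain ⟨hi, hrange⟩ := he T hT
  rw [eval_eq_sum f T (Finset.univ.image (e T)), Finset.sum_image hi.injOn]
  · simp only [Finset.mem_image, Finset.mem_univ, true_and]
    rintro _ ⟨i, rfl⟩
    exact (hrange.subset ⟨i, rfl⟩).1
  · intro p hp hfp
    obtain ⟨i, rfl⟩ := hrange.superset ⟨hp, subset_tsupport _ hfp⟩
    simp

theorem isCompact_hull (T : LabeledDelone d X) : IsCompact T.hull := by
  obtain ⟨r, hr, h⟩ := T.uniformlyDiscrete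
  obtain ⟨R, hR, h'⟩ := T.relativelyDense
  have hK := isCompact_setOf (d := d) (X := X) r R hr hR
  refine hK.of_isClosed_subset isClosed_closure (closure_minimal ?_ hK.isClosed)
  rintro _ ⟨x, rfl⟩
  refine ⟨?_, fun y => ?_⟩
  · rintro _ ⟨p, hp, rfl⟩ _ ⟨q, hq, rfl⟩ hpq
    simpa using h p hp q hq (by rintro rfl; exact hpq rfl)
  · obtain ⟨p, hp, hpy⟩ := h' (y + x)
    refine ⟨_, ⟨p, hp, rfl⟩, ?_⟩
    rw [dist_eq_norm] at hpy ⊢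
    convert hpy using 2
    simp only
    abel

end LabeledDelone

/-- A (minimal) tiling space: the hull of a labeled Delone set, in which every translation orbit
is dense. -/
structure TilingSpace (d : ℕ) (X : Type u) [MetricSpace X] where
  carrier : Set (LabeledDelone d X)
  exists_hull_eq : ∃ T : LabeledDelone d X, T.hull = carrier
  minimal : ∀ T ∈ carrier, carrier ⊆ T.hull

namespace TilingSpace

variable {d : ℕ} {X : Type u} [MetricSpace X]

instance : CoeSort (TilingSpace d X) (Type u) := ⟨fun Ω => Ω.carrier⟩

/-- The translation action: `Ω.translate T x` is `T - x`. -/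
def translate (Ω : TilingSpace d X) (T : Ω) (x : EuclideanSpace ℝ (Fin d)) : Ω :=
  ⟨T.1.translate x, by
    obtain ⟨S, hS⟩ := Ω.exists_hull_eq
    exact hS.subset (LabeledDelone.translate_mem_hull (hS.superset T.2) x)⟩

theorem continuous_translate (Ω : TilingSpace d X) (x : EuclideanSpace ℝ (Fin d)) :
    Continuous (fun T : Ω => Ω.translate T x) :=
  ((LabeledDelone.continuous_translate x).comp continuous_subtype_val).subtype_mk _

/-- No tiling has a nonzero period. -/
def IsAperiodic (Ω : TilingSpace d X) : Prop :=
  ∀ (T : Ω) (x : EuclideanSpace ℝ (Fin d)), Ω.translate T x = T → x = 0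

/-- Finite local complexity: for each radius `R`, up to translation only finitely many patches
of radius `R` occur in the tilings of `Ω`. (The patch of `T` around `x` is, up to translation,
the patch of `T - x ∈ Ω` around the origin.) -/
def IsFLC (Ω : TilingSpace d X) : Prop :=
  ∀ R : ℝ, ∃ F : Set (Set (EuclideanSpace ℝ (Fin d) × X)), F.Finite ∧
    ∀ T : Ω, ∃ P ∈ F, ∃ v : EuclideanSpace ℝ (Fin d),
      T.1.patch R = (fun p => (p.1 + v, p.2)) '' P

/-- A function on `Ω` is strongly pattern-equivariant if its value at `T` depends only on the
patch of `T` of some fixed radius around the origin. -/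
def IsStronglyPE (Ω : TilingSpace d X) (s : Ω → EuclideanSpace ℝ (Fin d)) : Prop :=
  ∃ R : ℝ, ∀ T T' : Ω, T.1.patch R = T'.1.patch R → s T = s T'

theorem IsStronglyPE.add {Ω : TilingSpace d X} {s t : Ω → EuclideanSpace ℝ (Fin d)}
    (hs : Ω.IsStronglyPE s) (ht : Ω.IsStronglyPE t) :
    Ω.IsStronglyPE (fun T => s T + t T) := by
  obtain ⟨R, hR⟩ := hs
  obtain ⟨R', hR'⟩ := ht
  have mono : ∀ {r r' : ℝ}, r ≤ r' → ∀ T T' : Ω, T.1.patch r' = T'.1.patch r' →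
      T.1.patch r = T'.1.patch r := by
    intro r r' hr T T' h
    ext p
    have hp := Set.ext_iff.1 h p
    simp only [LabeledDelone.patch, Set.mem_ofPred_eq] at hp ⊢
    constructor
    · exact fun h1 => ⟨(hp.1 ⟨h1.1, h1.2.trans_le hr⟩).1, h1.2⟩
    · exact fun h1 => ⟨(hp.2 ⟨h1.1, h1.2.trans_le hr⟩).1, h1.2⟩
  exact ⟨max R R', fun T T' h => congrArg₂ (· + ·) (hR T T' (mono (le_max_left _ _) T T' h))
    (hR' T T' (mono (le_max_right _ _) T T' h))⟩

theorem IsStronglyPE.neg {Ω : TilingSpace d X} {s : Ω → EuclideanSpace ℝ (Fin d)}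
    (hs : Ω.IsStronglyPE s) : Ω.IsStronglyPE (fun T => -s T) := by
  obtain ⟨R, hR⟩ := hs
  exact ⟨R, fun T T' h => congrArg (-·) (hR T T' h)⟩

/-- Weak dynamical `1`-cocycles with values in `ℝ^d`: continuous functions `α` on `Ω × ℝ^d`
such that `α(T, x) + α(T - x, y) = α(T, x + y)`. -/
def weakCocycles (Ω : TilingSpace d X) :
    AddSubgroup C(Ω × EuclideanSpace ℝ (Fin d), EuclideanSpace ℝ (Fin d)) where
  carrier := {α | ∀ T x y, α (T, x) + α (Ω.translate T x, y) = α (T, x + y)}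
  zero_mem' := by simp
  add_mem' := by
    intro α β hα hβ T x y
    simp only [ContinuousMap.add_apply, ← hα T x y, ← hβ T x y]
    abel
  neg_mem' := by
    intro α hα T x y
    simp only [ContinuousMap.neg_apply, ← hα T x y, neg_add]

/-- Weak coboundaries: cocycles of the form `(T, v) ↦ s(T - v) - s(T)` with `s` continuous. -/
def weakCoboundaries (Ω : TilingSpace d X) : AddSubgroup Ω.weakCocycles where
  carrier := {α | ∃ s : C(Ω, EuclideanSpace ℝ (Fin d)),
    ∀ T v, α.1 (T, v) = s (Ω.translate T v) - s T}
  zero_mem' := ⟨0, by simp⟩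
  add_mem' := by
    rintro α β ⟨s, hs⟩ ⟨t, ht⟩
    refine ⟨s + t, fun T v => ?_⟩
    simp only [AddSubgroup.coe_add, ContinuousMap.add_apply, hs, ht]
    abel
  neg_mem' := by
    rintro α ⟨s, hs⟩
    refine ⟨-s, fun T v => ?_⟩
    simp only [AddSubgroup.coe_neg, ContinuousMap.neg_apply, hs]
    abel

/-- Strong cocycles: cocycles `α` such that `T ↦ α(T, v)` is strongly pattern-equivariant for
each `v`. -/
def strongCocycles (Ω : TilingSpace d X) : AddSubgroup Ω.weakCocycles where
  carrier := {α | ∀ v, Ω.IsStronglyPE fun T => α.1 (T, v)}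
  zero_mem' := fun _ => ⟨0, fun _ _ _ => rfl⟩
  add_mem' := fun hα hβ v => (hα v).add (hβ v)
  neg_mem' := fun hα v => (hα v).neg

/-- Strong coboundaries: cocycles of the form `(T, v) ↦ s(T - v) - s(T)` with `s` continuous
and strongly pattern-equivariant. -/
def strongCoboundaries (Ω : TilingSpace d X) : AddSubgroup Ω.strongCocycles where
  carrier := {α | ∃ s : C(Ω, EuclideanSpace ℝ (Fin d)), Ω.IsStronglyPE s ∧
    ∀ T v, α.1.1 (T, v) = s (Ω.translate T v) - s T}
  zero_mem' := ⟨0, ⟨0, fun _ _ _ => rfl⟩, by simp⟩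
  add_mem' := by
    rintro α β ⟨s, hs', hs⟩ ⟨t, ht', ht⟩
    refine ⟨s + t, hs'.add ht', fun T v => ?_⟩
    simp only [AddSubgroup.coe_add, ContinuousMap.add_apply, hs, ht]
    abel
  neg_mem' := by
    rintro α ⟨s, hs', hs⟩
    refine ⟨-s, hs'.neg, fun T v => ?_⟩
    simp only [AddSubgroup.coe_neg, ContinuousMap.neg_apply, hs]
    abel

/-- The weak cohomology group `H^1_w(Ω; ℝ^d)`. -/
abbrev H1w (Ω : TilingSpace d X) : Type u := Ω.weakCocycles ⧸ Ω.weakCoboundaries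

/-- The strong cohomology group `H^1_s(Ω; ℝ^d)`. -/
abbrev H1s (Ω : TilingSpace d X) : Type u := Ω.strongCocycles ⧸ Ω.strongCoboundaries

/-- The natural map `H^1_s(Ω; ℝ^d) → H^1_w(Ω; ℝ^d)`. -/
noncomputable def strongToWeak (Ω : TilingSpace d X) : Ω.H1s →+ Ω.H1w :=
  QuotientAddGroup.map _ _ Ω.strongCocycles.subtype (by
    rintro α ⟨s, -, hs⟩
    exact ⟨s, hs⟩)

/-- A translation-invariant Borel probability measure on `Ω`. -/
structure InvariantMeasure (Ω : TilingSpace d X) where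
  toMeasure : Measure Ω
  isProbabilityMeasure : IsProbabilityMeasure toMeasure
  map_translate : ∀ x : EuclideanSpace ℝ (Fin d),
    toMeasure.map (fun T => Ω.translate T x) = toMeasure

/-- There is exactly one translation-invariant Borel probability measure on `Ω`. -/
def IsUniquelyErgodic (Ω : TilingSpace d X) : Prop :=
  ∃ μ : Ω.InvariantMeasure, ∀ ν : Ω.InvariantMeasure, ν = μ

variable [CompactSpace X]

instance (Ω : TilingSpace d X) : CompactSpace Ω := by
  obtain ⟨T, hT⟩ := Ω.exists_hull_eq
  exact isCompact_iff_compactSpace.1 (hT ▸ T.isCompact_hull)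

theorem integrable (Ω : TilingSpace d X) (μ : Ω.InvariantMeasure) {f : Ω → ℝ}
    (hf : Continuous f) : Integrable f μ.toMeasure :=
  haveI := μ.isProbabilityMeasure
  hf.integrable_of_hasCompactSupport (HasCompactSupport.of_compactSpace f)

/-- The Ruelle--Sullivan map: the class of a cocycle `α` is sent to the matrix of the linear map
`v ↦ ∫ α(T, v) dμ(T)`. If `α` is the integral of a closed `1`-form `ω`, that is
`α(T, v) = ∫₀¹ ω(T - t v) v dt`, then by invariance of `μ` this is the matrix `∫ ω(T) dμ(T)`. -/
noncomputable def ruelleSullivan (Ω : TilingSpace d X) (μ : Ω.InvariantMeasure) :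
    Ω.H1w →+ Matrix (Fin d) (Fin d) ℝ :=
  QuotientAddGroup.lift _
    { toFun := fun α => Matrix.of fun i j =>
        ∫ T, α.1 (T, EuclideanSpace.single j 1) i ∂μ.toMeasure
      map_add' := by
        intro α β
        ext i j
        simp only [AddSubgroup.coe_add, ContinuousMap.add_apply, PiLp.add_apply, Matrix.of_apply,
          Matrix.add_apply]
        exact integral_add (Ω.integrable μ (by fun_prop)) (Ω.integrable μ (by fun_prop))
      map_zero' := by
        ext i j
        simp }
    (by
      rintro α ⟨s, hs⟩
      ext i j
      have hc : Continuous fun T : Ω => s T i := by fun_prop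
      have hm := Ω.continuous_translate (EuclideanSpace.single j 1)
      simp only [AddMonoidHom.coe_mk, ZeroHom.coe_mk, Matrix.of_apply, Matrix.zero_apply, hs,
        PiLp.sub_apply]
      have hcm : Continuous fun T : Ω => s (Ω.translate T (EuclideanSpace.single j 1)) i :=
        hc.comp hm
      rw [integral_sub (Ω.integrable μ hcm) (Ω.integrable μ hc), sub_eq_zero]
      conv_rhs => rw [← μ.map_translate (EuclideanSpace.single j 1)]
      exact (integral_map hm.measurable.aemeasurable hc.aestronglyMeasurable).symm)

end TilingSpace

/-- `h : Ω → Ω'` is the shape deformation induced by the cocycle `α`: each `α(T, ·)` is a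
homeomorphism of `ℝ^d` that carries the points of `T` to the points of `h(T)`, and
`h(T - x) = h(T) - α(T, x)`. -/
structure IsShapeDeformation {d : ℕ} {X Y : Type u} [MetricSpace X] [MetricSpace Y]
    (Ω : TilingSpace d X) (Ω' : TilingSpace d Y) (α : Ω.weakCocycles) (h : Ω → Ω') : Prop where
  isHomeomorph : ∀ T, IsHomeomorph fun x => α.1 (T, x)
  image_points : ∀ T : Ω, (fun x => α.1 (T, x)) '' T.1.points = (h T).1.points
  map_translate : ∀ T x, h (Ω.translate T x) = Ω'.translate (h T) (α.1 (T, x))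

/-! ### Limits of labeled Delone sets in the vague topology -/

namespace LabeledDelone

variable {d : ℕ} {X : Type u}

/-! A cocycle `α` is cohomologous to each of its averages `(T, v) ↦ ∫ φ(z) α(T - t z, v) dz`, with
`φ` a Lipschitz probability density on the unit ball: the difference is the coboundary of `T ↦ ∫
φ(z) α(T, t z) dz`. The class `c` may therefore be represented by an average, and two averagings
produce a representative close to the linear map `A` with matrix `C_μ(c)`.

The first averaging is at a large scale `n`. By unique ergodicity, orbit averages of continuous
functions converge uniformly in `T`, so the averaged cocycle is uniformly close to `A v` for `‖v‖ ≤
2` (`IsUniquelyErgodic.eventually_forall_norm_smooth_sub_le`). This is only a sup estimate and says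
nothing about injectivity at small distances. The second averaging, at scale one, repairs this: the
shift by `v` falls on the Lipschitz weight, and a sup bound `ε` for the difference from `A` becomes
a bound by a multiple of `ε ‖v‖` (`norm_smooth_one_le`), which additivity extends to all `v`. Hence
each `α₀(T, ·)` is a small Lipschitz perturbation of an invertible linear map, that is, a
bi-Lipschitz homeomorphism (`exists_isBiLipschitz_of_norm_sub_le`).

The deformation moves the points of `T` by `α₀(T, ·)`. It is continuous and carries orbits onto
orbits, so its image is again a minimal tiling space; the labels serve to make it injective
(`exists_homeomorph_deform`). In the weak case the image of `x` is labeled by `T - x` itself, which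
is possible because `Ω` is compact and metrizable. In the strong case it is labeled by the patch of
a large radius `ρ` around `x`; with FLC there are finitely many such labels. Since `α₀(T, v)`
depends only on the patch of radius `‖v‖ + R₀`, the patch known around one point locates the images
of nearby points, whose labels enlarge the known patch step by step (`injective_deform_patchLabel`).
Averaging preserves the strong class because a strong cocycle has such an `R₀` uniform in `v`, which
follows from Baire's theorem (`exists_radius_of_mem_strongCocycles`). -/

theorem mem_points {T : LabeledDelone d X} {x : EuclideanSpace ℝ (Fin d)} :
    x ∈ T.points ↔ ∃ l, (x, l) ∈ T.carrier := by
  simp [LabeledDelone.points]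

theorem mem_translate {T : LabeledDelone d X} {x : EuclideanSpace ℝ (Fin d)}
    {p : EuclideanSpace ℝ (Fin d) × X} :
    p ∈ (T.translate x).carrier ↔ (p.1 + x, p.2) ∈ T.carrier := by
  constructor
  · rintro ⟨q, hq, rfl⟩
    simpa using hq
  · intro h
    exact ⟨_, h, by simp⟩

theorem translate_zero (T : LabeledDelone d X) : T.translate 0 = T :=
  LabeledDelone.ext (Set.ext fun p => by simp [mem_translate])

theorem nonempty_carrier (T : LabeledDelone d X) : T.carrier.Nonempty := by
  obtain ⟨R, -, h⟩ := T.relativelyDense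
  obtain ⟨p, hp, -⟩ := h 0
  exact ⟨p, hp⟩

variable [MetricSpace X]

theorem eval_eq_zero {f : C_c(EuclideanSpace ℝ (Fin d) × X, ℝ)} {T : LabeledDelone d X}
    (h : ∀ p ∈ T.carrier, f p = 0) : eval f T = 0 := by
  rw [eval_eq_sum f T ∅ (by simp) fun p hp hfp => absurd (h p hp) hfp, Finset.sum_empty]

theorem exists_mem_ne_zero {f : C_c(EuclideanSpace ℝ (Fin d) × X, ℝ)} {T : LabeledDelone d X}
    (h : eval f T ≠ 0) : ∃ p ∈ T.carrier, f p ≠ 0 := by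
  by_contra! h'
  exact h (eval_eq_zero h')

theorem le_eval {f : C_c(EuclideanSpace ℝ (Fin d) × X, ℝ)} (hf : ∀ p, 0 ≤ f p)
    {T : LabeledDelone d X} {p : EuclideanSpace ℝ (Fin d) × X} (hp : p ∈ T.carrier) :
    f p ≤ eval f T := by
  by_cases h0 : f p = 0
  · rw [h0]
    exact finsum_nonneg fun q => finsum_nonneg fun _ => hf q
  have hfin := T.finite_inter f.hasCompactSupport
  rw [eval_eq_sum f T hfin.toFinset (by simp +contextual)]
  · exact Finset.single_le_sum (f := fun q => f q) (fun q _ => hf q)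
      (hfin.mem_toFinset.2 ⟨hp, subset_tsupport _ h0⟩)
  · exact fun q hq hfq => hfin.mem_toFinset.2 ⟨hq, subset_tsupport _ hfq⟩

variable [CompactSpace X]

/-- The tent function of radius `r` around `q`. -/
noncomputable def tent (q : EuclideanSpace ℝ (Fin d) × X) (r : ℝ) :
    C_c(EuclideanSpace ℝ (Fin d) × X, ℝ) where
  toFun p := max 0 (r - dist p q)
  continuous_toFun := by fun_prop
  hasCompactSupport' := by
    refine HasCompactSupport.intro (isCompact_closedBall q r) fun p hp => ?_
    rw [Metric.mem_closedBall, not_le] at hp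
    exact max_eq_left (by linarith)

theorem tent_apply (q p : EuclideanSpace ℝ (Fin d) × X) (r : ℝ) :
    tent q r p = max 0 (r - dist p q) := rfl

theorem tent_nonneg (q p : EuclideanSpace ℝ (Fin d) × X) (r : ℝ) : 0 ≤ tent q r p :=
  le_max_left _ _

theorem exists_nearest (T : LabeledDelone d X) (q : EuclideanSpace ℝ (Fin d) × X) :
    ∃ p ∈ T.carrier, ∀ p' ∈ T.carrier, dist p q ≤ dist p' q := by
  obtain ⟨p₀, hp₀⟩ := T.nonempty_carrier
  obtain ⟨p, hp, hmin⟩ := Set.exists_min_image _ (fun p => dist p q)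
    (T.finite_inter (isCompact_closedBall q (dist p₀ q))) ⟨p₀, hp₀, Metric.mem_closedBall.2 le_rfl⟩
  refine ⟨p, hp.1, fun p' hp' => ?_⟩
  by_cases h : dist p' q ≤ dist p₀ q
  · exact hmin p' ⟨hp', h⟩
  · exact (Metric.mem_closedBall.1 hp.2).trans (not_le.1 h).le

/-- The tent around `q` has positive evaluation at `S`, an open condition, and positive evaluation
forces a point in its support. -/
theorem eventually_exists_dist_lt {Z : Type*} {l : Filter Z} {H : Z → LabeledDelone d X}
    {S : LabeledDelone d X} (hH : Filter.Tendsto H l (𝓝 S)) {q : EuclideanSpace ℝ (Fin d) × X}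
    (hq : q ∈ S.carrier) {r : ℝ} (hr : 0 < r) :
    ∀ᶠ z in l, ∃ p ∈ (H z).carrier, dist p q < r := by
  have h0 : 0 < eval (tent q r) S := by
    refine lt_of_lt_of_le ?_ (le_eval (tent_nonneg q · r) hq)
    simpa [tent_apply] using hr
  filter_upwards [(((continuous_eval (tent q r)).tendsto S).comp hH).eventually
    (eventually_gt_nhds h0)] with z hz
  obtain ⟨p, hp, hpz⟩ := exists_mem_ne_zero hz.ne'
  refine ⟨p, hp, ?_⟩
  by_contra! h
  exact hpz (max_eq_left (by linarith))

/-- Otherwise the tent around `q` that just reaches the nearest point of `S` evaluates to zero at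
`S`, while its evaluation at `H z` is at least its value at `g z`, which tends to a positive number.
-/
theorem mem_carrier_of_tendsto {Z : Type*} {l : Filter Z} [l.NeBot] {H : Z → LabeledDelone d X}
    {S : LabeledDelone d X} (hH : Filter.Tendsto H l (𝓝 S)) {q : EuclideanSpace ℝ (Fin d) × X}
    {g : Z → EuclideanSpace ℝ (Fin d) × X} (hg : ∀ᶠ z in l, g z ∈ (H z).carrier)
    (hgq : Filter.Tendsto g l (𝓝 q)) : q ∈ S.carrier := by
  obtain ⟨p, hp, hmin⟩ := S.exists_nearest q
  by_contra hq
  have hr : 0 < dist p q := dist_pos.2 (by rintro rfl; exact hq hp)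
  have h1 := ((continuous_eval (tent q (dist p q))).tendsto S).comp hH
  rw [eval_eq_zero fun p' hp' => max_eq_left (by linarith [hmin p' hp'])] at h1
  have h2 := ((tent q (dist p q)).continuous.tendsto q).comp hgq
  have h3 : tent q (dist p q) q ≤ 0 := by
    refine le_of_tendsto_of_tendsto h2 h1 ?_
    filter_upwards [hg] with z hz
    exact le_eval (tent_nonneg q · _) hz
  simp only [tent_apply, dist_self, sub_zero] at h3
  exact absurd (le_max_right 0 (dist p q)) (by linarith)

/-- A point belongs to the limit of `H` iff it is a limit of points of `H z`. -/
theorem mem_carrier_iff_of_tendsto {Z : Type*} {l : Filter Z} [l.NeBot]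
    {H : Z → LabeledDelone d X} {S : LabeledDelone d X} (hH : Filter.Tendsto H l (𝓝 S))
    {q : EuclideanSpace ℝ (Fin d) × X} :
    q ∈ S.carrier ↔ ∃ g : Z → EuclideanSpace ℝ (Fin d) × X,
      (∀ z, g z ∈ (H z).carrier) ∧ Filter.Tendsto g l (𝓝 q) := by
  constructor
  · intro hq
    choose g hg hmin using fun z => (H z).exists_nearest q
    refine ⟨g, hg, Metric.tendsto_nhds.2 fun r hr => ?_⟩
    filter_upwards [eventually_exists_dist_lt hH hq hr] with z ⟨p, hp, hpq⟩
    exact (hmin z p hp).trans_lt hpq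
  · rintro ⟨g, hg, hgq⟩
    exact mem_carrier_of_tendsto hH (Filter.Eventually.of_forall hg) hgq

/-- A map to Delone sets with uniform constants is continuous at `z₀` if the limit points of the
points of `H z` as `z → z₀` are the points of `H z₀`. -/
theorem continuousAt_of_limits {Z : Type*} [TopologicalSpace Z] {H : Z → LabeledDelone d X}
    {K : Set (LabeledDelone d X)} (hK : IsCompact K) (hHK : ∀ z, H z ∈ K) {z₀ : Z}
    (h₁ : ∀ U : Ultrafilter Z, ↑U ≤ 𝓝 z₀ → ∀ q ∈ (H z₀).carrier,
      ∃ g : Z → EuclideanSpace ℝ (Fin d) × X,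
        (∀ z, g z ∈ (H z).carrier) ∧ Filter.Tendsto g U (𝓝 q))
    (h₂ : ∀ U : Ultrafilter Z, ↑U ≤ 𝓝 z₀ → ∀ g : Z → EuclideanSpace ℝ (Fin d) × X,
      (∀ z, g z ∈ (H z).carrier) → ∀ q, Filter.Tendsto g U (𝓝 q) → q ∈ (H z₀).carrier) :
    ContinuousAt H z₀ := by
  rw [ContinuousAt, Filter.tendsto_iff_ultrafilter]
  intro U hU
  -- Compactness provides a limit along the ultrafilter; it remains to identify it through its
  -- points.
  obtain ⟨S, -, hS⟩ := isCompact_iff_ultrafilter_le_nhds'.1 hK (U.map H)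
    (Filter.mem_map.2 (Filter.Eventually.of_forall hHK))
  replace hS : Filter.Tendsto H U (𝓝 S) := hS
  suffices h : S = H z₀ by rwa [← h]
  refine LabeledDelone.ext (Set.ext fun q => ?_)
  rw [mem_carrier_iff_of_tendsto hS]
  constructor
  · rintro ⟨g, hg, hgq⟩
    exact h₂ U hU g hg q hgq
  · exact h₁ U hU q

end LabeledDelone

/-! ### Uniform constants, joint continuity and metrizability of tiling spaces -/

namespace TilingSpace

open LabeledDelone (mem_points mem_translate)

variable {d : ℕ} {X : Type u} [MetricSpace X]

theorem translate_translate (Ω : TilingSpace d X) (T : Ω) (x y : EuclideanSpace ℝ (Fin d)) :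
    Ω.translate (Ω.translate T x) y = Ω.translate T (x + y) :=
  Subtype.ext (T.1.translate_translate x y)

theorem translate_zero (Ω : TilingSpace d X) (T : Ω) : Ω.translate T 0 = T :=
  Subtype.ext T.1.translate_zero

theorem mem_points_translate {Ω : TilingSpace d X} {T : Ω} {x y : EuclideanSpace ℝ (Fin d)} :
    y ∈ (Ω.translate T x).1.points ↔ y + x ∈ T.1.points := by
  simp only [mem_points]
  exact exists_congr fun l => mem_translate

instance (Ω : TilingSpace d X) : Nonempty Ω := by
  obtain ⟨T, hT⟩ := Ω.exists_hull_eq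
  exact ⟨⟨T, hT ▸ subset_closure ⟨0, T.translate_zero⟩⟩⟩

variable [CompactSpace X]

/-- All elements of a tiling space share constants of uniform discreteness and relative density. -/
theorem exists_uniform (Ω : TilingSpace d X) : ∃ r R : ℝ, 0 < r ∧ 0 < R ∧ ∀ T : Ω,
    (∀ p ∈ T.1.carrier, ∀ q ∈ T.1.carrier, p ≠ q → r ≤ dist p.1 q.1) ∧
    ∀ x : EuclideanSpace ℝ (Fin d), ∃ p ∈ T.1.carrier, dist p.1 x ≤ R := by
  obtain ⟨T, hT⟩ := Ω.exists_hull_eq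
  obtain ⟨r, hr, h⟩ := T.uniformlyDiscrete
  obtain ⟨R, hR, h'⟩ := T.relativelyDense
  have hK := LabeledDelone.isCompact_setOf (d := d) (X := X) r R hr hR
  refine ⟨r, R, hr, hR, fun S => ?_⟩
  refine (closure_minimal (s := Set.range T.translate) ?_ hK.isClosed) (hT.superset S.2)
  rintro _ ⟨x, rfl⟩
  refine ⟨fun p hp q hq hpq => ?_, fun y => ?_⟩
  · rw [mem_translate] at hp hq
    have := h _ hp _ hq fun he => hpq (by
      rw [Prod.ext_iff] at he ⊢
      exact ⟨add_right_cancel he.1, he.2⟩)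
    simpa using this
  · obtain ⟨p, hp, hpy⟩ := h' (y + x)
    refine ⟨(p.1 - x, p.2), mem_translate.2 (by simpa using hp), ?_⟩
    rw [dist_eq_norm] at hpy ⊢
    convert hpy using 2
    simp only
    abel

/-- Translation is jointly continuous. -/
theorem continuous_translate_uncurry (Ω : TilingSpace d X) :
    Continuous fun z : Ω × EuclideanSpace ℝ (Fin d) => Ω.translate z.1 z.2 := by
  refine Continuous.subtype_mk (continuous_iff_continuousAt.2 fun z₀ => ?_) _
  have hK : IsCompact Ω.carrier := isCompact_iff_compactSpace.2 inferInstance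
  have hlim : ∀ U : Ultrafilter (Ω × EuclideanSpace ℝ (Fin d)), ↑U ≤ 𝓝 z₀ →
      Filter.Tendsto (fun z : Ω × EuclideanSpace ℝ (Fin d) => z.1.1) U (𝓝 z₀.1.1) ∧
      Filter.Tendsto (fun z : Ω × EuclideanSpace ℝ (Fin d) => z.2) U (𝓝 z₀.2) :=
    fun U hU => ⟨(Continuous.tendsto (by fun_prop) z₀).mono_left hU,
      (Continuous.tendsto (by fun_prop) z₀).mono_left hU⟩
  refine LabeledDelone.continuousAt_of_limits hK
    (fun z : Ω × EuclideanSpace ℝ (Fin d) => (Ω.translate z.1 z.2).2) ?_ ?_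
  · intro U hU q hq
    obtain ⟨h1, h2⟩ := hlim U hU
    obtain ⟨g, hg, hgq⟩ := (LabeledDelone.mem_carrier_iff_of_tendsto h1).1 (mem_translate.1 hq)
    refine ⟨fun z => ((g z).1 - z.2, (g z).2), fun z => ?_, ?_⟩
    · exact mem_translate.2 (by simpa using hg z)
    · have := (((continuous_fst.tendsto _).comp hgq).sub h2).prodMk_nhds
        ((continuous_snd.tendsto _).comp hgq)
      simpa using this
  · intro U hU g hg q hgq
    obtain ⟨h1, h2⟩ := hlim U hU
    refine mem_translate.2 ((LabeledDelone.mem_carrier_iff_of_tendsto h1).2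
      ⟨fun z => ((g z).1 + z.2, (g z).2), fun z => mem_translate.1 (hg z), ?_⟩)
    exact (((continuous_fst.tendsto _).comp hgq).add h2).prodMk_nhds
        ((continuous_snd.tendsto _).comp hgq)

/-- Countably many tents, with centers in a dense sequence and radii `1 / (k + 1)`, separate points,
and `Ω` is compact. Metrizability lets `Ω` serve as its own space of labels. -/
instance (Ω : TilingSpace d X) : TopologicalSpace.MetrizableSpace Ω := by
  have : Nonempty (EuclideanSpace ℝ (Fin d) × X) := by
    obtain ⟨T⟩ := (inferInstance : Nonempty Ω)
    exact T.1.nonempty_carrier.nonempty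
  obtain ⟨q, hq⟩ := TopologicalSpace.exists_dense_seq (EuclideanSpace ℝ (Fin d) × X)
  have key : ∀ T T' : LabeledDelone d X, (∃ p ∈ T.carrier, p ∉ T'.carrier) →
      ∃ i : ℕ × ℕ, LabeledDelone.eval (LabeledDelone.tent (q i.1) (1 / ((i.2 : ℝ) + 1))) T ≠
        LabeledDelone.eval (LabeledDelone.tent (q i.1) (1 / ((i.2 : ℝ) + 1))) T' := by
    rintro T T' ⟨p, hp, hp'⟩
    obtain ⟨p₁, hp₁, hmin⟩ := T'.exists_nearest p
    have hr : 0 < dist p₁ p := dist_pos.2 (by rintro rfl; exact hp' hp₁)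
    -- The radius is less than half the distance from `p` to `T'` and the center is closer to `p`
    -- than the radius, so the tent is positive at `p` and vanishes on `T'`.
    obtain ⟨k, hk⟩ := exists_nat_one_div_lt (half_pos hr)
    obtain ⟨n, hn⟩ := hq.exists_dist_lt p (Nat.one_div_pos_of_nat (α := ℝ) (n := k))
    refine ⟨(n, k), ne_of_gt ?_⟩
    rw [LabeledDelone.eval_eq_zero (T := T')]
    · refine lt_of_lt_of_le ?_ (LabeledDelone.le_eval (LabeledDelone.tent_nonneg _ · _) hp)
      exact lt_max_of_lt_right (by linarith)
    · intro p₂ hp₂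
      refine max_eq_left ?_
      have h1 := hmin p₂ hp₂
      have h2 := dist_triangle_right p₂ p (q n)
      linarith
  refine Metric.PiNatEmbed.TopologicalSpace.MetrizableSpace.of_countable_separating
    (fun (i : ℕ × ℕ) (T : Ω) =>
      LabeledDelone.eval (LabeledDelone.tent (q i.1) (1 / ((i.2 : ℝ) + 1))) T.1)
    (fun i => (LabeledDelone.continuous_eval _).comp continuous_subtype_val) fun T T' hne => ?_
  by_cases h : T.1.carrier ⊆ T'.1.carrier
  · by_cases h' : T'.1.carrier ⊆ T.1.carrier
    · exact absurd (Subtype.ext (LabeledDelone.ext (h.antisymm h'))) hne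
    · obtain ⟨i, hi⟩ := key _ _ (Set.not_subset.1 h')
      exact ⟨i, hi.symm⟩
  · exact key _ _ (Set.not_subset.1 h)

end TilingSpace

/-! ### Bi-Lipschitz cocycles and the deformations they induce -/

namespace TilingSpace

open LabeledDelone (mem_points mem_translate)

section Cocycle

variable {d : ℕ} {X : Type u} [MetricSpace X] {Ω : TilingSpace d X}

theorem cocycle_add (α : Ω.weakCocycles) (T : Ω) (x y : EuclideanSpace ℝ (Fin d)) :
    α.1 (T, x + y) = α.1 (T, x) + α.1 (Ω.translate T x, y) :=
  (α.2 T x y).symm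

theorem cocycle_sub (α : Ω.weakCocycles) (T : Ω) (x y : EuclideanSpace ℝ (Fin d)) :
    α.1 (Ω.translate T x, y - x) = α.1 (T, y) - α.1 (T, x) := by
  rw [eq_sub_iff_add_eq', ← cocycle_add, add_sub_cancel]

theorem cocycle_translate (α : Ω.weakCocycles) (T : Ω) (x y : EuclideanSpace ℝ (Fin d)) :
    α.1 (Ω.translate T x, y) = α.1 (T, x + y) - α.1 (T, x) := by
  rw [← cocycle_sub, add_sub_cancel_left]

theorem cocycle_zero (α : Ω.weakCocycles) (T : Ω) : α.1 (T, 0) = 0 := by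
  have := cocycle_add α T 0 0
  rwa [translate_zero, add_zero, left_eq_add] at this

/-- The maps `α(T, ·)` are homeomorphisms that distort distances by bounded factors. -/
structure IsBiLipschitz (α : Ω.weakCocycles) (K M : ℝ) : Prop where
  pos_left : 0 < K
  pos_right : 0 < M
  norm_le : ∀ T v, ‖v‖ ≤ K * ‖α.1 (T, v)‖
  norm_apply_le : ∀ T v, ‖α.1 (T, v)‖ ≤ M * ‖v‖
  isHomeomorph : ∀ T, IsHomeomorph fun x => α.1 (T, x)

variable {α : Ω.weakCocycles} {K M : ℝ}

theorem IsBiLipschitz.dist_le (hα : IsBiLipschitz α K M) (T : Ω)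
    (x y : EuclideanSpace ℝ (Fin d)) : dist x y ≤ K * dist (α.1 (T, x)) (α.1 (T, y)) := by
  rw [dist_eq_norm, dist_eq_norm, ← cocycle_sub]
  exact hα.norm_le _ _

theorem IsBiLipschitz.dist_apply_le (hα : IsBiLipschitz α K M) (T : Ω)
    (x y : EuclideanSpace ℝ (Fin d)) : dist (α.1 (T, x)) (α.1 (T, y)) ≤ M * dist x y := by
  rw [dist_eq_norm, dist_eq_norm, ← cocycle_sub]
  exact hα.norm_apply_le _ _

theorem IsBiLipschitz.injective (hα : IsBiLipschitz α K M) (T : Ω) :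
    Function.Injective fun x => α.1 (T, x) :=
  (hα.isHomeomorph T).injective

end Cocycle

section Deformation

variable {d : ℕ} {X Y : Type u} [MetricSpace X] {Ω : TilingSpace d X}
  {α : Ω.weakCocycles} {K M : ℝ}

theorem IsBiLipschitz.le_dist_image (hα : IsBiLipschitz α K M) (L : Ω → Y) {r : ℝ} (T : Ω)
    (h : ∀ p ∈ T.1.carrier, ∀ q ∈ T.1.carrier, p ≠ q → r ≤ dist p.1 q.1) :
    ∀ p ∈ (fun x => (α.1 (T, x), L (Ω.translate T x))) '' T.1.points,
      ∀ q ∈ (fun x => (α.1 (T, x), L (Ω.translate T x))) '' T.1.points, p ≠ q →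
        r / K ≤ dist p.1 q.1 := by
  rintro _ ⟨x, hx, rfl⟩ _ ⟨y, hy, rfl⟩ hne
  obtain ⟨l, hl⟩ := mem_points.1 hx
  obtain ⟨l', hl'⟩ := mem_points.1 hy
  have h1 := h _ hl _ hl' fun he => hne (by rw [show x = y from congrArg Prod.fst he])
  rw [div_le_iff₀' hα.pos_left]
  exact h1.trans (hα.dist_le T x y)

theorem IsBiLipschitz.exists_dist_image_le (hα : IsBiLipschitz α K M) (L : Ω → Y) {R : ℝ}
    (T : Ω) (h : ∀ x : EuclideanSpace ℝ (Fin d), ∃ p ∈ T.1.carrier, dist p.1 x ≤ R)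
    (y : EuclideanSpace ℝ (Fin d)) :
    ∃ p ∈ (fun x => (α.1 (T, x), L (Ω.translate T x))) '' T.1.points, dist p.1 y ≤ M * R := by
  obtain ⟨x, rfl⟩ := (hα.isHomeomorph T).surjective y
  obtain ⟨p, hp, hpx⟩ := h x
  exact ⟨_, ⟨p.1, ⟨p, hp, rfl⟩, rfl⟩, (hα.dist_apply_le T _ _).trans
    (mul_le_mul_of_nonneg_left hpx hα.pos_right.le)⟩

/-- The image of `T` under the deformation `α(T, ·)`, the image of the point `x` being labeled
by `L(T - x)`. -/
def deform (hα : IsBiLipschitz α K M) (L : Ω → Y) (T : Ω) : LabeledDelone d Y where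
  carrier := (fun x => (α.1 (T, x), L (Ω.translate T x))) '' T.1.points
  uniformlyDiscrete := by
    obtain ⟨r, hr, h⟩ := T.1.uniformlyDiscrete
    exact ⟨r / K, div_pos hr hα.pos_left, hα.le_dist_image L T h⟩
  relativelyDense := by
    obtain ⟨R, hR, h⟩ := T.1.relativelyDense
    exact ⟨M * R, mul_pos hα.pos_right hR, hα.exists_dist_image_le L T h⟩

theorem mem_deform {hα : IsBiLipschitz α K M} {L : Ω → Y} {T : Ω}
    {q : EuclideanSpace ℝ (Fin d) × Y} : q ∈ (deform hα L T).carrier ↔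
      ∃ x ∈ T.1.points, (α.1 (T, x), L (Ω.translate T x)) = q := Iff.rfl

theorem points_deform (hα : IsBiLipschitz α K M) (L : Ω → Y) (T : Ω) :
    (deform hα L T).points = (fun x => α.1 (T, x)) '' T.1.points := by
  change Prod.fst '' ((fun x => (α.1 (T, x), L (Ω.translate T x))) '' T.1.points) = _
  rw [Set.image_image]

theorem deform_translate (hα : IsBiLipschitz α K M) (L : Ω → Y) (T : Ω)
    (x : EuclideanSpace ℝ (Fin d)) :
    deform hα L (Ω.translate T x) = (deform hα L T).translate (α.1 (T, x)) := by
  refine LabeledDelone.ext (Set.ext fun q => ?_)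
  rw [mem_translate, mem_deform, mem_deform]
  constructor
  · rintro ⟨y, hy, rfl⟩
    refine ⟨y + x, mem_points_translate.1 hy, ?_⟩
    rw [add_comm y x, cocycle_add, translate_translate, add_comm (α.1 (T, x))]
  · rintro ⟨y, hy, hq⟩
    refine ⟨y - x, mem_points_translate.2 (by simpa using hy), ?_⟩
    rw [Prod.ext_iff] at hq ⊢
    rw [cocycle_sub, translate_translate, add_sub_cancel]
    exact ⟨by rw [sub_eq_iff_eq_add]; exact hq.1, hq.2⟩

/-- Two tilings with a common translate are equal if the translation vectors have the same image
under `α`. -/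
theorem IsBiLipschitz.eq_of_translate_eq (hα : IsBiLipschitz α K M) {T T' : Ω}
    {x y : EuclideanSpace ℝ (Fin d)} (h : Ω.translate T x = Ω.translate T' y)
    (hxy : α.1 (T, x) = α.1 (T', y)) : T = T' := by
  -- Since `α(T - x, -x) = -α(T, x)`, and likewise for `T'`, the two return vectors have the same
  -- image under the injective map `α(T - x, ·)`.
  have h1 : α.1 (Ω.translate T x, -x) = α.1 (Ω.translate T x, -y) := by
    have ha := cocycle_translate α T x (-x)
    have hb := cocycle_translate α T' y (-y)
    rw [add_neg_cancel, cocycle_zero] at ha hb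
    rw [ha, h, hb, hxy]
  have h2 := neg_injective (hα.injective _ h1)
  rw [← h2] at h
  have h3 := congrArg (Ω.translate · (-x)) h
  simpa only [translate_translate, add_neg_cancel, translate_zero] using h3

/-- Equality of the deformations of `T` and `T'` gives points of `T` and `T'` with the same image
and the same label. -/
theorem exists_of_deform_eq {hα : IsBiLipschitz α K M} {L : Ω → Y} {T T' : Ω}
    (h : deform hα L T = deform hα L T') {x : EuclideanSpace ℝ (Fin d)} (hx : x ∈ T.1.points) :
    ∃ y ∈ T'.1.points, α.1 (T', y) = α.1 (T, x) ∧
      L (Ω.translate T' y) = L (Ω.translate T x) := by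
  have h1 : (α.1 (T, x), L (Ω.translate T x)) ∈ (deform hα L T).carrier :=
    mem_deform.2 ⟨x, hx, rfl⟩
  rw [h] at h1
  obtain ⟨y, hy, hyx⟩ := mem_deform.1 h1
  exact ⟨y, hy, Prod.ext_iff.1 hyx⟩

/-- Labeling the image of `x` by `T - x` itself makes the deformation injective. -/
theorem injective_deform_of_injective (hα : IsBiLipschitz α K M) {L : Ω → Y}
    (hL : Function.Injective L) : Function.Injective (deform hα L) := by
  intro T T' h
  obtain ⟨p, hp⟩ := T.1.nonempty_carrier
  obtain ⟨y, -, hy, hyL⟩ := exists_of_deform_eq h (x := p.1) ⟨p, hp, rfl⟩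
  exact hα.eq_of_translate_eq (hL hyL.symm) hy.symm

variable [MetricSpace Y] [CompactSpace X] [CompactSpace Y]

/-- Limits of points of the deformations are images of limits of points of the tilings. Labels are
read only at `T - x` with `x` a point of `T`, so continuity of `L` is needed only on tilings with a
point at the origin; patch labels satisfy no more than this. -/
theorem continuous_deform (hα : IsBiLipschitz α K M) {L : Ω → Y}
    (hL : ContinuousOn L {T | 0 ∈ T.1.points}) : Continuous (deform hα L) := by
  obtain ⟨r, R, hr, hR, hrR⟩ := Ω.exists_uniform
  have hlim : ∀ (U : Ultrafilter Ω) (T₀ : Ω) (g : Ω → EuclideanSpace ℝ (Fin d)) (x),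
      ↑U ≤ 𝓝 T₀ → (∀ T : Ω, g T ∈ T.1.points) → Filter.Tendsto g U (𝓝 x) → x ∈ T₀.1.points →
      Filter.Tendsto (fun T => (α.1 (T, g T), L (Ω.translate T (g T)))) U
        (𝓝 (α.1 (T₀, x), L (Ω.translate T₀ x))) := by
    intro U T₀ g x hU hg hgx hx
    have h1 : Filter.Tendsto (fun T => (T, g T)) U (𝓝 (T₀, x)) :=
      Filter.Tendsto.prodMk_nhds (Filter.tendsto_id'.2 hU) hgx
    refine ((α.1.continuous.tendsto _).comp h1).prodMk_nhds ?_
    have h2 : ContinuousWithinAt L {T | 0 ∈ T.1.points} (Ω.translate T₀ x) :=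
      hL _ (mem_points_translate.2 (by simpa using hx))
    refine h2.tendsto.comp (tendsto_nhdsWithin_iff.2
      ⟨(Ω.continuous_translate_uncurry.tendsto _).comp h1, Filter.Eventually.of_forall fun T => ?_⟩)
    exact mem_points_translate.2 (by simpa using hg T)
  refine continuous_iff_continuousAt.2 fun T₀ => ?_
  refine LabeledDelone.continuousAt_of_limits
    (LabeledDelone.isCompact_setOf (r / K) (M * R) (div_pos hr hα.pos_left)
      (mul_pos hα.pos_right hR))
    (fun T => ⟨hα.le_dist_image L T (hrR T).1, hα.exists_dist_image_le L T (hrR T).2⟩) ?_ ?_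
  · intro U hU q hq
    obtain ⟨x, hx, rfl⟩ := mem_deform.1 hq
    obtain ⟨l, hl⟩ := mem_points.1 hx
    obtain ⟨g, hg, hgx⟩ := (LabeledDelone.mem_carrier_iff_of_tendsto
      ((continuous_subtype_val.tendsto T₀).mono_left hU)).1 hl
    have hg' : ∀ T : Ω, (g T).1 ∈ T.1.points := fun T => mem_points.2 ⟨_, hg T⟩
    exact ⟨_, fun T => mem_deform.2 ⟨_, hg' T, rfl⟩,
      hlim U T₀ (fun T => (g T).1) x hU hg' ((continuous_fst.tendsto _).comp hgx) hx⟩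
  · intro U hU g hg q hgq
    choose y hy hyg using fun T => mem_deform.1 (hg T)
    choose l hl using fun T : Ω => mem_points.1 (hy T)
    -- The lower bi-Lipschitz bound keeps the preimages of a convergent family of points bounded,
    -- hence convergent along the ultrafilter.
    have hbd : ∀ᶠ T in (U : Filter Ω), (y T, l T) ∈
        Metric.closedBall (0 : EuclideanSpace ℝ (Fin d)) (K * (‖q.1‖ + 1)) ×ˢ
          (Set.univ : Set X) := by
      have h1 : Filter.Tendsto (fun T => ‖(g T).1‖) U (𝓝 ‖q.1‖) :=
        ((continuous_fst.tendsto _).comp hgq).norm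
      filter_upwards [h1.eventually (eventually_lt_nhds (lt_add_one _))] with T hT
      refine ⟨?_, trivial⟩
      rw [mem_closedBall_zero_iff]
      refine (hα.norm_le T (y T)).trans (mul_le_mul_of_nonneg_left ?_ hα.pos_left.le)
      rw [← hyg T] at hT
      exact hT.le
    obtain ⟨p, -, hp⟩ := isCompact_iff_ultrafilter_le_nhds'.1
      ((isCompact_closedBall (0 : EuclideanSpace ℝ (Fin d)) (K * (‖q.1‖ + 1))).prod
        (isCompact_univ (X := X))) (U.map fun T => (y T, l T)) (Filter.mem_map.2 hbd)
    replace hp : Filter.Tendsto (fun T => (y T, l T)) U (𝓝 p) := hp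
    have hpT := (LabeledDelone.mem_carrier_iff_of_tendsto
      ((continuous_subtype_val.tendsto T₀).mono_left hU)).2 ⟨_, hl, hp⟩
    have hpT' : p.1 ∈ T₀.1.points := mem_points.2 ⟨_, hpT⟩
    have h2 := hlim U T₀ y p.1 hU hy ((continuous_fst.tendsto _).comp hp) hpT'
    simp only [hyg] at h2
    exact mem_deform.2 ⟨p.1, hpT', tendsto_nhds_unique h2 hgq⟩

/-- If the labels determine `T` from its deformation, the deformation is a homeomorphism onto a
tiling space. -/
theorem exists_homeomorph_deform (hα : IsBiLipschitz α K M) {L : Ω → Y}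
    (hL : ContinuousOn L {T | 0 ∈ T.1.points}) (hinj : Function.Injective (deform hα L)) :
    ∃ (Ω' : TilingSpace d Y) (h : Ω ≃ₜ Ω'), (∀ T, (h T).1 = deform hα L T) ∧
      IsShapeDeformation Ω Ω' α h ∧ (Ω.IsAperiodic → Ω'.IsAperiodic) := by
  have hcont := continuous_deform hα hL
  -- Surjectivity of `α(T, ·)` makes the orbit of the image the image of the orbit. That every hull
  -- is the full range gives both that the range is a hull and that it is minimal.
  have horbit : ∀ T : Ω, (deform hα L T).hull = Set.range (deform hα L) := by
    intro T
    have h1 : Set.range (deform hα L T).translate = deform hα L '' Set.range (Ω.translate T) := by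
      rw [← Set.range_comp]
      ext S
      constructor
      · rintro ⟨y, rfl⟩
        obtain ⟨x, rfl⟩ := (hα.isHomeomorph T).surjective y
        exact ⟨x, deform_translate hα L T x⟩
      · rintro ⟨x, rfl⟩
        exact ⟨_, (deform_translate hα L T x).symm⟩
    have hdense : Dense (Set.range (Ω.translate T)) := by
      intro S
      rw [closure_subtype, ← Set.range_comp]
      exact Ω.minimal T.1 T.2 S.2
    rw [LabeledDelone.hull, h1]
    refine Set.Subset.antisymm (closure_minimal (Set.image_subset_range _ _)
      (isCompact_range hcont).isClosed) ?_
    exact hcont.range_subset_closure_image_dense hdense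
  obtain ⟨T₁⟩ := (inferInstance : Nonempty Ω)
  let Ω' : TilingSpace d Y :=
    { carrier := Set.range (deform hα L)
      exists_hull_eq := ⟨_, horbit T₁⟩
      minimal := by
        rintro _ ⟨T, rfl⟩
        exact (horbit T).superset }
  let h : Ω ≃ₜ Ω' := (hcont.isClosedEmbedding hinj).isEmbedding.toHomeomorph
  refine ⟨Ω', h, fun T => rfl, ⟨hα.isHomeomorph, fun T => (points_deform hα L T).symm,
    fun T x => Subtype.ext (deform_translate hα L T x)⟩, fun hap S x hx => ?_⟩
  obtain ⟨T, rfl⟩ := h.surjective S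
  -- A period of the image has the form `α(T, y)`; injectivity of `h` makes `y` a period of `T`.
  obtain ⟨y, rfl⟩ := (hα.isHomeomorph T).surjective x
  have h1 : h (Ω.translate T y) = h T :=
    (Subtype.ext (deform_translate hα L T y) : h (Ω.translate T y) = Ω'.translate (h T) _).trans hx
  rw [hap T y (h.injective h1)]
  exact cocycle_zero α T

end Deformation

end TilingSpace

/-! ### Averaging cocycles against a Lipschitz weight -/

/-- A probability density supported in the unit ball, with Lipschitz constant `κ`. -/
structure IsWeight {d : ℕ} (φ : EuclideanSpace ℝ (Fin d) → ℝ) (κ : NNReal) : Prop where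
  nonneg : ∀ z, 0 ≤ φ z
  lipschitz : LipschitzWith κ φ
  eq_zero : ∀ z, 1 < ‖z‖ → φ z = 0
  integral_eq_one : ∫ z, φ z = 1

theorem exists_isWeight (d : ℕ) : ∃ (φ : EuclideanSpace ℝ (Fin d) → ℝ) (κ : NNReal),
    IsWeight φ κ := by
  let f : ContDiffBump (0 : EuclideanSpace ℝ (Fin d)) := ⟨1 / 2, 1, by norm_num, by norm_num⟩
  obtain ⟨κ, hκ⟩ := ContDiff.lipschitzWith_of_hasCompactSupport (𝕂 := ℝ) (n := 1)
    (f.hasCompactSupport_normed (μ := volume)) (f.contDiff_normed (n := 1)) one_ne_zero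
  refine ⟨f.normed volume, κ, f.nonneg_normed, hκ, fun z hz => ?_, f.integral_normed⟩
  have h : z ∉ Function.support (f.normed volume) := by
    rw [f.support_normed_eq]
    simpa using hz.le
  simpa using h

namespace IsWeight

variable {d : ℕ} {φ : EuclideanSpace ℝ (Fin d) → ℝ} {κ : NNReal}
  {F : Type*} [NormedAddCommGroup F] [NormedSpace ℝ F]

theorem hasCompactSupport (hφ : IsWeight φ κ) : HasCompactSupport φ :=
  HasCompactSupport.intro (isCompact_closedBall 0 1) fun z hz => hφ.eq_zero z (by simpa using hz)

theorem integrable_smul (hφ : IsWeight φ κ) {G : EuclideanSpace ℝ (Fin d) → F}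
    (hG : Continuous G) : Integrable fun z => φ z • G z :=
  (hφ.lipschitz.continuous.smul hG).integrable_of_hasCompactSupport hφ.hasCompactSupport.smul_right

theorem integrable (hφ : IsWeight φ κ) : Integrable φ :=
  hφ.lipschitz.continuous.integrable_of_hasCompactSupport hφ.hasCompactSupport

theorem integral_smul_const [CompleteSpace F] (hφ : IsWeight φ κ) (x : F) :
    ∫ z, φ z • x = x := by
  rw [_root_.integral_smul_const, hφ.integral_eq_one, one_smul]

theorem norm_integral_smul_le (hφ : IsWeight φ κ) {G : EuclideanSpace ℝ (Fin d) → F} {ε : ℝ}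
    (hε : ∀ z, ‖G z‖ ≤ ε) : ‖∫ z, φ z • G z‖ ≤ ε := by
  refine (norm_integral_le_of_norm_le (hφ.integrable.mul_const ε)
    (Filter.Eventually.of_forall fun z => ?_)).trans_eq ?_
  · rw [norm_smul, Real.norm_of_nonneg (hφ.nonneg z)]
    exact mul_le_mul_of_nonneg_left (hε z) (hφ.nonneg z)
  · rw [integral_mul_const, hφ.integral_eq_one, one_mul]

/-- A weighted average changes little under small shifts of the integrand. -/
theorem norm_integral_shift_le (hφ : IsWeight φ κ) {G : EuclideanSpace ℝ (Fin d) → F}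
    (hG : Continuous G) {ε : ℝ} (hε : ∀ w, ‖w‖ ≤ 2 → ‖G w‖ ≤ ε)
    {v : EuclideanSpace ℝ (Fin d)} (hv : ‖v‖ ≤ 1) :
    ‖∫ z, φ z • (G (z + v) - G z)‖ ≤
      κ * ‖v‖ * ε * volume.real (Metric.closedBall (0 : EuclideanSpace ℝ (Fin d)) 2) := by
  -- Moving the shift onto the weight yields the factor `κ ‖v‖` without any regularity of `G` beyond
  -- continuity.
  have h1 : ∫ z, φ z • G (z + v) = ∫ z, φ (z - v) • G z := by
    rw [← integral_sub_right_eq_self (fun z => φ z • G (z + v)) v]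
    simp
  have hint : Integrable fun z => φ (z - v) • G z := by
    have := (hφ.integrable_smul (G := fun z => G (z + v)) (by fun_prop)).comp_sub_right v
    simpa using this
  have h2 : ∫ z, φ z • (G (z + v) - G z) =
      ∫ z in Metric.closedBall 0 2, (φ (z - v) - φ z) • G z := by
    simp only [smul_sub]
    rw [integral_sub (hφ.integrable_smul (by fun_prop)) (hφ.integrable_smul hG), h1,
      ← integral_sub hint (hφ.integrable_smul hG)]
    simp only [← sub_smul]
    refine (setIntegral_eq_integral_of_forall_compl_eq_zero fun z hz => ?_).symm
    have hz2 : 2 < ‖z‖ := by simpa using hz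
    rw [hφ.eq_zero z (by linarith), hφ.eq_zero (z - v), sub_zero, zero_smul]
    linarith [norm_sub_norm_le z v]
  rw [h2]
  refine norm_setIntegral_le_of_norm_le_const measure_closedBall_lt_top fun z hz => ?_
  rw [norm_smul]
  have h3 : ‖φ (z - v) - φ z‖ ≤ κ * ‖v‖ := by
    have := hφ.lipschitz.dist_le_mul (z - v) z
    rwa [dist_eq_norm, dist_eq_norm, sub_sub_cancel_left, norm_neg] at this
  exact mul_le_mul h3 (hε z (by simpa using hz)) (norm_nonneg _) (by positivity)

end IsWeight

namespace TilingSpace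

variable {d : ℕ} {X : Type u} [MetricSpace X] {Ω : TilingSpace d X}

variable (Ω) in
/-- A linear map, as a cocycle independent of the tiling. -/
def linearCocycle (A : EuclideanSpace ℝ (Fin d) →L[ℝ] EuclideanSpace ℝ (Fin d)) :
    Ω.weakCocycles :=
  ⟨⟨fun z => A z.2, by fun_prop⟩, fun T x y => (A.map_add x y).symm⟩

theorem sub_linearCocycle_apply (α : Ω.weakCocycles)
    (A : EuclideanSpace ℝ (Fin d) →L[ℝ] EuclideanSpace ℝ (Fin d)) (T : Ω)
    (v : EuclideanSpace ℝ (Fin d)) :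
    (α - linearCocycle Ω A).1 (T, v) = α.1 (T, v) - A v := rfl

theorem continuous_cocycle_translate (α : Ω.weakCocycles) (T : Ω) (t : ℝ)
    (v : EuclideanSpace ℝ (Fin d)) :
    Continuous fun z : EuclideanSpace ℝ (Fin d) => α.1 (Ω.translate T (t • z), v) := by
  simp only [cocycle_translate]
  fun_prop

/-- A long vector is a sum of `n` equal short ones, and by the cocycle identity the value is a sum
of `n` values along the orbit, each at most `c ‖v‖ / n`. -/
theorem norm_cocycle_le (γ : Ω.weakCocycles) {c : ℝ}
    (hc : ∀ T v, ‖v‖ ≤ 1 → ‖γ.1 (T, v)‖ ≤ c * ‖v‖) (T : Ω) (v : EuclideanSpace ℝ (Fin d)) :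
    ‖γ.1 (T, v)‖ ≤ c * ‖v‖ := by
  have key : ∀ (n : ℕ) (T : Ω) (w : EuclideanSpace ℝ (Fin d)), ‖w‖ ≤ 1 →
      ‖γ.1 (T, (n : ℝ) • w)‖ ≤ n * (c * ‖w‖) := by
    intro n
    induction n with
    | zero => intro T w _; simp [cocycle_zero]
    | succ n ih =>
      intro T w hw
      have : ((n + 1 : ℕ) : ℝ) • w = (n : ℝ) • w + w := by push_cast; rw [add_smul, one_smul]
      rw [this, cocycle_add]
      refine (norm_add_le _ _).trans ?_
      push_cast
      linarith [ih T w hw, hc (Ω.translate T ((n : ℝ) • w)) w hw]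
  obtain ⟨n, hn⟩ := exists_nat_ge (max 1 ‖v‖)
  have hn1 : (1 : ℝ) ≤ n := (le_max_left _ _).trans hn
  have hn0 : (0 : ℝ) < n := by linarith
  have hw : ‖(n : ℝ)⁻¹ • v‖ = ‖v‖ / n := by
    rw [norm_smul, norm_inv, Real.norm_of_nonneg hn0.le, inv_mul_eq_div]
  have h := key n T ((n : ℝ)⁻¹ • v) (by
    rw [hw, div_le_one hn0]
    exact (le_max_right _ _).trans hn)
  rw [smul_inv_smul₀ hn0.ne', hw] at h
  refine h.trans_eq ?_
  field_simp

/-- A cocycle close to an invertible linear map is bi-Lipschitz. -/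
theorem exists_isBiLipschitz_of_norm_sub_le (β : Ω.weakCocycles)
    (A : EuclideanSpace ℝ (Fin d) ≃L[ℝ] EuclideanSpace ℝ (Fin d)) {c : ℝ} (hc0 : 0 < c)
    (hc : c * ‖(A.symm : EuclideanSpace ℝ (Fin d) →L[ℝ] EuclideanSpace ℝ (Fin d))‖ ≤ 1 / 2)
    (h : ∀ T v, ‖β.1 (T, v) - A v‖ ≤ c * ‖v‖) : ∃ K M, IsBiLipschitz β K M := by
  set N := ‖(A.symm : EuclideanSpace ℝ (Fin d) →L[ℝ] EuclideanSpace ℝ (Fin d))‖ with hN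
  have hN0 : 0 ≤ N := norm_nonneg _
  -- From `‖v‖ ≤ N ‖A v‖ ≤ N ‖β(T, v)‖ + ‖v‖ / 2` the constant `2 N` suffices; the summand `1` keeps
  -- it positive when `N = 0`, that is, in dimension zero.
  refine ⟨2 * N + 1, ‖(A : EuclideanSpace ℝ (Fin d) →L[ℝ] EuclideanSpace ℝ (Fin d))‖ + c,
    by positivity, by positivity, fun T v => ?_, fun T v => ?_, fun T => ?_⟩
  · have h1 : ‖v‖ ≤ N * ‖A v‖ := by
      have := (A.symm : EuclideanSpace ℝ (Fin d) →L[ℝ] EuclideanSpace ℝ (Fin d)).le_opNorm (A v)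
      simpa using this
    have h2 : ‖A v‖ ≤ ‖β.1 (T, v)‖ + c * ‖v‖ := by
      have := norm_sub_norm_le (A v) (β.1 (T, v))
      rw [norm_sub_rev] at this
      linarith [h T v]
    have h3 := mul_le_mul_of_nonneg_left h2 hN0
    have h4 := mul_le_mul_of_nonneg_right hc (norm_nonneg v)
    nlinarith [norm_nonneg (β.1 (T, v))]
  · have h1 := (A : EuclideanSpace ℝ (Fin d) →L[ℝ] EuclideanSpace ℝ (Fin d)).le_opNorm v
    have h2 : ‖β.1 (T, v)‖ ≤ ‖A v‖ + ‖β.1 (T, v) - A v‖ := norm_le_norm_add_norm_sub' _ _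
    have h3 := h T v
    rw [add_mul]
    exact h2.trans (add_le_add h1 h3)
  · have hap : ApproximatesLinearOn (fun x => β.1 (T, x))
        (A : EuclideanSpace ℝ (Fin d) →L[ℝ] EuclideanSpace ℝ (Fin d)) Set.univ
        c.toNNReal := by
      intro x _ y _
      rw [← cocycle_sub, Real.coe_toNNReal c hc0.le]
      exact h _ _
    refine (hap.toHomeomorph _ ?_).isHomeomorph
    rcases subsingleton_or_nontrivial (EuclideanSpace ℝ (Fin d)) with hs | hs
    · exact Or.inl hs
    · right
      have hpos : 0 < N := A.symm.norm_pos
      rw [← NNReal.coe_lt_coe, NNReal.coe_inv, coe_nnnorm, ← hN, Real.coe_toNNReal c hc0.le,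
        lt_inv_comm₀ hc0 hpos]
      rw [← le_div_iff₀' hc0] at hc
      refine hc.trans_lt ?_
      rw [div_lt_iff₀ hc0, inv_mul_cancel₀ hc0.ne']
      norm_num

variable [CompactSpace X]

/-- The coboundary of a continuous function, as a weak cocycle. -/
noncomputable def coboundary (s : C(Ω, EuclideanSpace ℝ (Fin d))) : Ω.weakCocycles :=
  ⟨⟨fun z => s (Ω.translate z.1 z.2) - s z.1,
    (s.continuous.comp Ω.continuous_translate_uncurry).sub (s.continuous.comp continuous_fst)⟩, by
    intro T x y
    simp only [ContinuousMap.coe_mk, translate_translate]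
    abel⟩

theorem coboundary_apply (s : C(Ω, EuclideanSpace ℝ (Fin d))) (T : Ω)
    (v : EuclideanSpace ℝ (Fin d)) : (coboundary s).1 (T, v) = s (Ω.translate T v) - s T := rfl

/-- The weighted average of `α(T, t z)` over `z`. -/
noncomputable def primitive {φ : EuclideanSpace ℝ (Fin d) → ℝ} {κ : NNReal} (hφ : IsWeight φ κ)
    (t : ℝ) (α : Ω.weakCocycles) : C(Ω, EuclideanSpace ℝ (Fin d)) where
  toFun T := ∫ z, φ z • α.1 (T, t • z)
  continuous_toFun := by
    have hc := hφ.lipschitz.continuous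
    have h := continuous_parametric_integral_of_continuous (μ := volume)
      (f := fun (T : Ω) z => φ z • α.1 (T, t • z)) (by unfold Function.uncurry; fun_prop)
      (isCompact_closedBall (0 : EuclideanSpace ℝ (Fin d)) 1)
    refine h.congr fun T => setIntegral_eq_integral_of_forall_compl_eq_zero fun z hz => ?_
    rw [hφ.eq_zero z (by simpa using hz), zero_smul]

theorem primitive_apply {φ : EuclideanSpace ℝ (Fin d) → ℝ} {κ : NNReal} (hφ : IsWeight φ κ)
    (t : ℝ) (α : Ω.weakCocycles) (T : Ω) :
    primitive hφ t α T = ∫ z, φ z • α.1 (T, t • z) := rfl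

/-- The cocycle cohomologous to `α` obtained by averaging `α(T - t z, ·)` over `z`. -/
noncomputable def smooth {φ : EuclideanSpace ℝ (Fin d) → ℝ} {κ : NNReal} (hφ : IsWeight φ κ)
    (t : ℝ) (α : Ω.weakCocycles) : Ω.weakCocycles :=
  α + coboundary (primitive hφ t α)

variable {φ : EuclideanSpace ℝ (Fin d) → ℝ} {κ : NNReal}

/-- Pointwise in `z`, `α(T, v) + α(T - v, t z) - α(T, t z) = α(T, v + t z) - α(T, t z) = α(T - t z,
v)`. -/
theorem smooth_apply (hφ : IsWeight φ κ) (t : ℝ) (α : Ω.weakCocycles) (T : Ω)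
    (v : EuclideanSpace ℝ (Fin d)) :
    (smooth hφ t α).1 (T, v) = ∫ z, φ z • α.1 (Ω.translate T (t • z), v) := by
  change α.1 (T, v) + (coboundary _).1 (T, v) = _
  rw [coboundary_apply, primitive_apply, primitive_apply]
  conv_lhs => enter [1]; rw [← hφ.integral_smul_const (α.1 (T, v))]
  have hint : ∀ S : Ω, Integrable fun z => φ z • α.1 (S, t • z) :=
    fun S => hφ.integrable_smul (by fun_prop)
  rw [← integral_sub (hint _) (hint _),
    ← integral_add (hφ.integrable_smul continuous_const) ((hint _).sub' (hint _))]
  refine integral_congr_ae (Filter.Eventually.of_forall fun z => ?_)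
  simp only
  rw [← smul_sub, ← smul_add, cocycle_translate, cocycle_translate, add_comm (t • z) v]
  congr 1
  abel

theorem smooth_sub_linearCocycle_apply (hφ : IsWeight φ κ) (t : ℝ) (α : Ω.weakCocycles)
    (A : EuclideanSpace ℝ (Fin d) →L[ℝ] EuclideanSpace ℝ (Fin d)) (T : Ω)
    (v : EuclideanSpace ℝ (Fin d)) :
    (smooth hφ t (α - linearCocycle Ω A)).1 (T, v) = (smooth hφ t α).1 (T, v) - A v := by
  rw [smooth_apply, smooth_apply]
  simp only [sub_linearCocycle_apply, smul_sub]
  rw [integral_sub (hφ.integrable_smul (continuous_cocycle_translate α T t v))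
    (hφ.integrable_smul continuous_const), hφ.integral_smul_const]

/-- This is the gain in regularity: the integrand is `γ(T, z + v) - γ(T, z)`, so a sup bound on the
ball of radius 2 becomes a bound linear in `‖v‖`. -/
theorem norm_smooth_one_le (hφ : IsWeight φ κ) (γ : Ω.weakCocycles) {ε : ℝ}
    (hε : ∀ T v, ‖v‖ ≤ 2 → ‖γ.1 (T, v)‖ ≤ ε) (T : Ω) {v : EuclideanSpace ℝ (Fin d)}
    (hv : ‖v‖ ≤ 1) : ‖(smooth hφ 1 γ).1 (T, v)‖ ≤
      κ * ‖v‖ * ε * volume.real (Metric.closedBall (0 : EuclideanSpace ℝ (Fin d)) 2) := by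
  rw [smooth_apply]
  simp only [cocycle_translate, one_smul]
  exact hφ.norm_integral_shift_le (G := fun z => γ.1 (T, z)) (by fun_prop) (hε T) hv

end TilingSpace

/-! ### Unique ergodicity and uniform convergence of the averages -/

namespace TilingSpace

variable {d : ℕ} {X : Type u} [MetricSpace X] [CompactSpace X] {Ω : TilingSpace d X}
  {φ : EuclideanSpace ℝ (Fin d) → ℝ} {κ : NNReal}

theorem continuous_translate_smul (T : Ω) (t : ℝ) :
    Continuous fun z : EuclideanSpace ℝ (Fin d) => Ω.translate T (t • z) :=
  Ω.continuous_translate_uncurry.comp (by fun_prop : Continuous fun z => (T, t • z))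

/-- The averages of a continuous function along an orbit are integrals against probability
measures on the tiling space. -/
theorem exists_probabilityMeasure_integral_eq (hφ : IsWeight φ κ) (T : Ω) (t : ℝ) :
    ∃ ν : ProbabilityMeasure Ω, ∀ f : C(Ω, ℝ),
      ∫ S, f S ∂(ν : Measure Ω) = ∫ z, φ z • f (Ω.translate T (t • z)) := by
  have hc := continuous_translate_smul T t
  let m : Measure (EuclideanSpace ℝ (Fin d)) :=
    volume.withDensity fun z => ENNReal.ofReal (φ z)
  have hm : IsProbabilityMeasure m := by
    refine ⟨?_⟩
    rw [withDensity_apply _ MeasurableSet.univ, Measure.restrict_univ, ← ofReal_integral_eq_lintegral_ofReal hφ.integrable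
      (Filter.Eventually.of_forall hφ.nonneg), hφ.integral_eq_one, ENNReal.ofReal_one]
  refine ⟨⟨m.map fun z => Ω.translate T (t • z),
    Measure.isProbabilityMeasure_map hc.measurable.aemeasurable⟩, fun f => ?_⟩
  rw [ProbabilityMeasure.coe_mk, integral_map hc.measurable.aemeasurable
    f.continuous.aestronglyMeasurable, integral_withDensity_eq_integral_toReal_smul
    hφ.lipschitz.continuous.measurable.ennreal_ofReal (by simp)]
  simp only [ENNReal.toReal_ofReal (hφ.nonneg _)]

/-- Limits of orbit averages over growing regions do not change when a function is composed with
a translation. -/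
theorem tendsto_integral_translate_sub (hφ : IsWeight φ κ) (f : C(Ω, ℝ)) (T : ℕ → Ω)
    (x : EuclideanSpace ℝ (Fin d)) :
    Filter.Tendsto (fun n : ℕ => ∫ z, φ z • (f (Ω.translate (Ω.translate (T n) ((n : ℝ) • z)) x) -
      f (Ω.translate (T n) ((n : ℝ) • z)))) Filter.atTop (𝓝 0) := by
  set V := volume.real (Metric.closedBall (0 : EuclideanSpace ℝ (Fin d)) 2)
  have hlim : Filter.Tendsto (fun n : ℕ => ‖x‖ / (n : ℝ)) Filter.atTop (𝓝 0) :=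
    tendsto_const_div_atTop_nhds_zero_nat _
  have hlim' : Filter.Tendsto (fun n : ℕ => κ * (‖x‖ / (n : ℝ)) * ‖f‖ * V) Filter.atTop (𝓝 0) := by
    simpa using ((hlim.const_mul (κ : ℝ)).mul_const ‖f‖).mul_const V
  refine squeeze_zero_norm' ?_ hlim'
  filter_upwards [hlim.eventually (eventually_le_nhds one_pos), Filter.eventually_gt_atTop 0]
    with n hn hn0
  have hn0' : (0 : ℝ) < n := by exact_mod_cast hn0
  have hx : ‖(n : ℝ)⁻¹ • x‖ = ‖x‖ / n := by
    rw [norm_smul, norm_inv, Real.norm_of_nonneg hn0'.le, inv_mul_eq_div]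
  -- At scale `n`, translating by `x` amounts to shifting `z` by `x / n`.
  have h := hφ.norm_integral_shift_le (G := fun z => f (Ω.translate (T n) ((n : ℝ) • z)))
    (f.continuous.comp (continuous_translate_smul _ _)) (fun w _ => f.norm_coe_le_norm _)
    (v := (n : ℝ)⁻¹ • x) (by rwa [hx])
  simpa only [smul_add, smul_inv_smul₀ hn0'.ne', translate_translate, hx] using h

/-- In a uniquely ergodic tiling space, orbit averages converge uniformly. -/
theorem IsUniquelyErgodic.eventually_abs_sub_lt (hΩ : Ω.IsUniquelyErgodic)
    (μ : Ω.InvariantMeasure) (hφ : IsWeight φ κ) (f : C(Ω, ℝ)) {ε : ℝ} (hε : 0 < ε) :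
    ∀ᶠ n : ℕ in Filter.atTop, ∀ T : Ω,
      |(∫ z, φ z • f (Ω.translate T ((n : ℝ) • z))) - ∫ S, f S ∂μ.toMeasure| < ε := by
  by_contra hcon
  rw [Filter.not_eventually] at hcon
  have hsel : ∀ n : ℕ, ∃ T : Ω, (¬ ∀ T : Ω,
      |(∫ z, φ z • f (Ω.translate T ((n : ℝ) • z))) - ∫ S, f S ∂μ.toMeasure| < ε) →
      ε ≤ |(∫ z, φ z • f (Ω.translate T ((n : ℝ) • z))) - ∫ S, f S ∂μ.toMeasure| := by
    intro n
    by_cases h : ∀ T : Ω,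
      |(∫ z, φ z • f (Ω.translate T ((n : ℝ) • z))) - ∫ S, f S ∂μ.toMeasure| < ε
    · exact ⟨Classical.arbitrary Ω, fun h' => absurd h h'⟩
    · push Not at h
      obtain ⟨T, hT⟩ := h
      exact ⟨T, fun _ => hT⟩
  choose T hT using hsel
  -- An ultrafilter finer than `l` tends to infinity within the scales at which the estimate fails
  -- for some tiling `T n`.
  let l : Filter ℕ := Filter.atTop ⊓ Filter.principal {n : ℕ | ¬ ∀ T : Ω,
      |(∫ z, φ z • f (Ω.translate T ((n : ℝ) • z))) - ∫ S, f S ∂μ.toMeasure| < ε}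
  have : l.NeBot := Filter.frequently_mem_iff_neBot.1 hcon
  let U : Ultrafilter ℕ := Ultrafilter.of l
  have hU : (U : Filter ℕ) ≤ l := Ultrafilter.of_le l
  have hUtop : (U : Filter ℕ) ≤ Filter.atTop := hU.trans inf_le_left
  have hUε : ∀ᶠ n in (U : Filter ℕ),
      ε ≤ |(∫ z, φ z • f (Ω.translate (T n) ((n : ℝ) • z))) - ∫ S, f S ∂μ.toMeasure| := by
    filter_upwards [(hU.trans inf_le_right) (Filter.mem_principal_self _)] with n hn
    exact hT n hn
  choose ν hν using fun n : ℕ => exists_probabilityMeasure_integral_eq hφ (T n) (n : ℝ)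
  -- The averaging measures have a weak limit by compactness of the probability measures on `Ω`. It
  -- is invariant, hence equal to `μ`, against the failure of the estimate.
  obtain ⟨ρ, -, hρ⟩ := isCompact_iff_ultrafilter_le_nhds'.1
    (isCompact_univ (X := ProbabilityMeasure Ω)) (U.map ν) Filter.univ_mem
  replace hρ : Filter.Tendsto ν U (𝓝 ρ) := hρ
  have hlim : ∀ g : C(Ω, ℝ), Filter.Tendsto
      (fun n : ℕ => ∫ z, φ z • g (Ω.translate (T n) ((n : ℝ) • z))) U
        (𝓝 (∫ S, g S ∂(ρ : Measure Ω))) := by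
    intro g
    have := ProbabilityMeasure.tendsto_iff_forall_integral_tendsto.1 hρ
      (BoundedContinuousFunction.mkOfCompact g)
    simpa only [BoundedContinuousFunction.mkOfCompact_apply, hν] using this
  let ρ' : Ω.InvariantMeasure := ⟨ρ, inferInstance, fun x => by
    have hx := Ω.continuous_translate x
    have := Measure.isProbabilityMeasure_map (μ := (ρ : Measure Ω)) hx.measurable.aemeasurable
    refine ext_of_forall_integral_eq_of_IsFiniteMeasure fun g => ?_
    rw [integral_map hx.measurable.aemeasurable g.continuous.aestronglyMeasurable]
    have h1 := (hlim ⟨fun S => g (Ω.translate S x), g.continuous.comp hx⟩).sub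
      (hlim g.toContinuousMap)
    have h2 := (tendsto_integral_translate_sub hφ g.toContinuousMap T x).mono_left hUtop
    refine sub_eq_zero.1 (tendsto_nhds_unique h1 (h2.congr fun n => ?_))
    simp only [smul_sub]
    have hc := continuous_translate_smul (T n) (n : ℝ)
    exact integral_sub (hφ.integrable_smul (g.continuous.comp (hx.comp hc)))
      (hφ.integrable_smul (g.continuous.comp hc))⟩
  have hρμ : (ρ : Measure Ω) = μ.toMeasure := by
    obtain ⟨μ₀, hμ₀⟩ := hΩ
    exact congrArg InvariantMeasure.toMeasure ((hμ₀ ρ').trans (hμ₀ μ).symm)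
  have h1 := ((hlim f).sub_const (∫ S, f S ∂μ.toMeasure)).abs
  rw [hρμ, sub_self, abs_zero] at h1
  exact absurd (ge_of_tendsto h1 hUε) (not_le.2 hε)

/-- The cocycle identity integrates to additivity because `μ` is invariant under translation by `x`.
-/
theorem integral_cocycle_add (μ : Ω.InvariantMeasure) (α : Ω.weakCocycles) (i : Fin d)
    (x y : EuclideanSpace ℝ (Fin d)) :
    ∫ T, α.1 (T, x + y) i ∂μ.toMeasure =
      ∫ T, α.1 (T, x) i ∂μ.toMeasure + ∫ T, α.1 (T, y) i ∂μ.toMeasure := by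
  have hm := Ω.continuous_translate x
  have hc : Continuous fun T : Ω => α.1 (T, y) i := by fun_prop
  have h1 : ∫ T, α.1 (T, y) i ∂μ.toMeasure =
      ∫ T, α.1 (Ω.translate T x, y) i ∂μ.toMeasure := by
    conv_lhs => rw [← μ.map_translate x]
    exact integral_map hm.measurable.aemeasurable hc.aestronglyMeasurable
  have hcm : Continuous fun T : Ω => α.1 (Ω.translate T x, y) i := hc.comp hm
  rw [h1, ← integral_add (Ω.integrable μ (by fun_prop)) (Ω.integrable μ hcm)]
  simp only [cocycle_add, PiLp.add_apply]

/-- The integrals of a cocycle depend linearly on the translation vector, and the matrix is the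
Ruelle--Sullivan matrix. -/
theorem integral_cocycle_eq (μ : Ω.InvariantMeasure) (α : Ω.weakCocycles) (i : Fin d)
    (v : EuclideanSpace ℝ (Fin d)) :
    ∫ T, α.1 (T, v) i ∂μ.toMeasure =
      Matrix.toEuclideanCLM (𝕜 := ℝ) (Ω.ruelleSullivan μ (QuotientAddGroup.mk α)) v i := by
  have := μ.isProbabilityMeasure
  have hcont : Continuous fun v => ∫ T, α.1 (T, v) i ∂μ.toMeasure := by
    have h := continuous_parametric_integral_of_continuous (μ := μ.toMeasure)
      (f := fun (v : EuclideanSpace ℝ (Fin d)) (T : Ω) => α.1 (T, v) i)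
      (by unfold Function.uncurry; fun_prop) isCompact_univ
    simpa only [Measure.restrict_univ] using h
  let m : EuclideanSpace ℝ (Fin d) →+ ℝ :=
    AddMonoidHom.mk' (fun v => ∫ T, α.1 (T, v) i ∂μ.toMeasure) (integral_cocycle_add μ α i)
  -- A continuous additive map is real linear, so it is enough to compare on the standard basis,
  -- where the matrix is defined.
  let l : EuclideanSpace ℝ (Fin d) →L[ℝ] ℝ := m.toRealLinearMap hcont
  have hl : l = (EuclideanSpace.proj i).comp
      (Matrix.toEuclideanCLM (𝕜 := ℝ) (Ω.ruelleSullivan μ (QuotientAddGroup.mk α))) := by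
    refine ContinuousLinearMap.coe_injective
      ((EuclideanSpace.basisFun (Fin d) ℝ).toBasis.ext fun j => ?_)
    simp only [OrthonormalBasis.coe_toBasis, EuclideanSpace.basisFun_apply]
    simp
    rfl
  exact congrArg (fun l : EuclideanSpace ℝ (Fin d) →L[ℝ] ℝ => l v) hl

theorem _root_.EuclideanSpace.norm_le_sum_abs {ι : Type*} [Fintype ι] (x : EuclideanSpace ℝ ι) :
    ‖x‖ ≤ ∑ i, |x i| := by
  rw [EuclideanSpace.norm_eq]
  refine Real.sqrt_le_iff.2 ⟨Finset.sum_nonneg fun i _ => abs_nonneg _, ?_⟩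
  exact Finset.sum_sq_le_sq_sum_of_nonneg fun i _ => abs_nonneg _

/-- For fixed `v`, uniform convergence of orbit averages is applied to each coordinate of `α(·, v)`.
Dividing `ε` by `d + 1` covers dimension zero. -/
theorem IsUniquelyErgodic.eventually_norm_smooth_sub_le (hΩ : Ω.IsUniquelyErgodic)
    (μ : Ω.InvariantMeasure) (hφ : IsWeight φ κ) (α : Ω.weakCocycles)
    (v : EuclideanSpace ℝ (Fin d)) {ε : ℝ} (hε : 0 < ε) :
    ∀ᶠ n : ℕ in Filter.atTop, ∀ T : Ω, ‖(smooth hφ n α).1 (T, v) -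
      Matrix.toEuclideanCLM (𝕜 := ℝ) (Ω.ruelleSullivan μ (QuotientAddGroup.mk α)) v‖ ≤ ε := by
  have hpos : 0 < ε / (d + 1) := by positivity
  have h := fun i : Fin d => hΩ.eventually_abs_sub_lt μ hφ
    ⟨fun T : Ω => α.1 (T, v) i, by fun_prop⟩ hpos
  filter_upwards [Filter.eventually_all.2 h] with n hn T
  refine (EuclideanSpace.norm_le_sum_abs _).trans ?_
  have hi : ∀ i : Fin d, |((smooth hφ n α).1 (T, v) - Matrix.toEuclideanCLM (𝕜 := ℝ)
      (Ω.ruelleSullivan μ (QuotientAddGroup.mk α)) v) i| ≤ ε / (d + 1) := by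
    intro i
    rw [PiLp.sub_apply, ← integral_cocycle_eq, smooth_apply]
    have h1 := (EuclideanSpace.proj (𝕜 := ℝ) i).integral_comp_comm
      (hφ.integrable_smul (continuous_cocycle_translate α T n v))
    have h2 := (hn i T).le
    exact (congrArg (fun x => |x - _|) h1).symm.trans_le h2
  refine (Finset.sum_le_sum fun i _ => hi i).trans ?_
  rw [Finset.sum_const, Finset.card_univ, Fintype.card_fin, nsmul_eq_mul, ← mul_div_assoc,
    div_le_iff₀ (by positivity)]
  nlinarith

/-- Equicontinuity of the family `γ(T, ·)`, by compactness of `Ω`. -/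
theorem eventually_forall_norm_cocycle_sub_lt (γ : Ω.weakCocycles) (v : EuclideanSpace ℝ (Fin d))
    {ε : ℝ} (hε : 0 < ε) :
    ∀ᶠ w in 𝓝 v, ∀ T, ‖γ.1 (T, w) - γ.1 (T, v)‖ < ε := by
  have h : ∀ T ∈ (Set.univ : Set Ω), ∀ᶠ z : EuclideanSpace ℝ (Fin d) × Ω in 𝓝 (v, T),
      ‖γ.1 (z.2, z.1) - γ.1 (z.2, v)‖ < ε := by
    intro T _
    have hc : Continuous fun z : EuclideanSpace ℝ (Fin d) × Ω =>
      ‖γ.1 (z.2, z.1) - γ.1 (z.2, v)‖ := by fun_prop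
    refine (hc.tendsto (v, T)).eventually (eventually_lt_nhds ?_)
    simpa using hε
  filter_upwards [isCompact_univ.eventually_forall_of_forall_eventually
    (P := fun w T => ‖γ.1 (T, w) - γ.1 (T, v)‖ < ε) h] with w hw T
  exact hw T trivial

/-- Pointwise convergence on a finite net of the ball suffices, since averaging over the orbit
preserves the equicontinuity bounds of `γ = α - A`, which hold for all tilings at once. -/
theorem IsUniquelyErgodic.eventually_forall_norm_smooth_sub_le (hΩ : Ω.IsUniquelyErgodic)
    (μ : Ω.InvariantMeasure) (hφ : IsWeight φ κ) (α : Ω.weakCocycles) (r : ℝ) {ε : ℝ}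
    (hε : 0 < ε) :
    ∀ᶠ n : ℕ in Filter.atTop, ∀ (T : Ω) (v : EuclideanSpace ℝ (Fin d)), ‖v‖ ≤ r →
      ‖(smooth hφ n α).1 (T, v) -
        Matrix.toEuclideanCLM (𝕜 := ℝ) (Ω.ruelleSullivan μ (QuotientAddGroup.mk α)) v‖ ≤ ε := by
  set A := Matrix.toEuclideanCLM (𝕜 := ℝ) (Ω.ruelleSullivan μ (QuotientAddGroup.mk α))
  set γ := α - linearCocycle Ω A
  obtain ⟨t, -, ht⟩ := (isCompact_closedBall (0 : EuclideanSpace ℝ (Fin d)) r).elim_nhds_subcover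
    (fun v => {w | ∀ T, ‖γ.1 (T, w) - γ.1 (T, v)‖ < ε / 2})
    (fun v _ => eventually_forall_norm_cocycle_sub_lt γ v (half_pos hε))
  filter_upwards [(Finset.eventually_all t).2 fun v _ =>
    hΩ.eventually_norm_smooth_sub_le μ hφ α v (half_pos hε)] with n hn T w hw
  obtain ⟨v, hv, hwv⟩ := Set.mem_iUnion₂.1 (ht (mem_closedBall_zero_iff.2 hw))
  have h1 := hn v hv T
  rw [← smooth_sub_linearCocycle_apply] at h1 ⊢
  have h2 : ‖(smooth hφ n γ).1 (T, w) - (smooth hφ n γ).1 (T, v)‖ ≤ ε / 2 := by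
    rw [smooth_apply, smooth_apply, ← integral_sub
      (hφ.integrable_smul (continuous_cocycle_translate γ T n w))
      (hφ.integrable_smul (continuous_cocycle_translate γ T n v))]
    simp only [← smul_sub]
    exact hφ.norm_integral_smul_le fun z => (hwv _).le
  have h3 := norm_le_norm_add_norm_sub' ((smooth hφ n γ).1 (T, w)) ((smooth hφ n γ).1 (T, v))
  linarith

/-- If the Ruelle--Sullivan matrix of `α` is invertible, averaging at a large scale and then at
unit scale makes `α` bi-Lipschitz. -/
theorem IsUniquelyErgodic.exists_isBiLipschitz_smooth (hΩ : Ω.IsUniquelyErgodic)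
    (μ : Ω.InvariantMeasure) (hφ : IsWeight φ κ) (α : Ω.weakCocycles)
    (hα : IsUnit (Ω.ruelleSullivan μ (QuotientAddGroup.mk α))) :
    ∃ (n : ℕ) (K M : ℝ), IsBiLipschitz (smooth hφ 1 (smooth hφ n α)) K M := by
  obtain ⟨u, hu⟩ := hα.map (Matrix.toEuclideanCLM (n := Fin d) (𝕜 := ℝ))
  let A := ContinuousLinearEquiv.unitsEquiv ℝ _ u
  have hA : (A : EuclideanSpace ℝ (Fin d) →L[ℝ] EuclideanSpace ℝ (Fin d)) =
      Matrix.toEuclideanCLM (𝕜 := ℝ) (Ω.ruelleSullivan μ (QuotientAddGroup.mk α)) := hu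
  set N := ‖(A.symm : EuclideanSpace ℝ (Fin d) →L[ℝ] EuclideanSpace ℝ (Fin d))‖ with hN
  have hN0 : 0 ≤ N := norm_nonneg _
  set V := volume.real (Metric.closedBall (0 : EuclideanSpace ℝ (Fin d)) 2) with hV
  have hV0 : 0 ≤ V := measureReal_nonneg
  obtain ⟨c, hc0, hcN⟩ : ∃ c : ℝ, 0 < c ∧ c * N ≤ 1 / 2 := by
    refine ⟨1 / (2 * (N + 1)), by positivity, ?_⟩
    rw [div_mul_eq_mul_div, div_le_div_iff₀ (by positivity) (by positivity)]
    linarith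
  -- The second averaging turns the sup bound `ε` into the Lipschitz bound `κ ε V`, which must not
  -- exceed the `c` allowed by `A`. The bound is needed up to radius 2 because the weight has
  -- support in the unit ball and `‖v‖ ≤ 1`.
  obtain ⟨ε, hε0, hε⟩ : ∃ ε : ℝ, 0 < ε ∧ κ * ε * V ≤ c := by
    refine ⟨c / (κ * V + 1), by positivity, ?_⟩
    rw [mul_div_assoc', div_mul_eq_mul_div, div_le_iff₀ (by positivity)]
    nlinarith
  obtain ⟨n, hn⟩ := (hΩ.eventually_forall_norm_smooth_sub_le μ hφ α 2 hε0).exists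
  rw [← hA] at hn
  refine ⟨n, exists_isBiLipschitz_of_norm_sub_le _ A hc0 hcN fun T v => ?_⟩
  have h := norm_cocycle_le (smooth hφ 1 (smooth hφ n α - linearCocycle Ω A)) (c := c) ?_ T v
  · rwa [smooth_sub_linearCocycle_apply] at h
  · intro T v hv
    refine (norm_smooth_one_le hφ _ (ε := ε) (fun T v hv => ?_) T hv).trans ?_
    · rw [sub_linearCocycle_apply]
      exact hn T v hv
    · rw [← hV]
      calc κ * ‖v‖ * ε * V = (κ * ε * V) * ‖v‖ := by ring
        _ ≤ c * ‖v‖ := mul_le_mul_of_nonneg_right hε (norm_nonneg v)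

end TilingSpace

/-! ### Strong cocycles and their averages -/

namespace TilingSpace

open LabeledDelone (mem_points mem_translate)

section PatternEquivariance

variable {d : ℕ} {X : Type u}

theorem _root_.LabeledDelone.mem_patch {T : LabeledDelone d X} {R : ℝ}
    {p : EuclideanSpace ℝ (Fin d) × X} : p ∈ T.patch R ↔ p ∈ T.carrier ∧ ‖p.1‖ < R := Iff.rfl

theorem _root_.LabeledDelone.mem_iff_of_patch_eq {T T' : LabeledDelone d X} {R : ℝ}
    (h : T.patch R = T'.patch R) {p : EuclideanSpace ℝ (Fin d) × X} (hp : ‖p.1‖ < R) :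
    p ∈ T.carrier ↔ p ∈ T'.carrier := by
  have := Set.ext_iff.1 h p
  simpa only [LabeledDelone.mem_patch, hp, and_true] using this

theorem _root_.LabeledDelone.patch_eq_of_le {T T' : LabeledDelone d X} {R R' : ℝ}
    (h : T.patch R' = T'.patch R') (hR : R ≤ R') : T.patch R = T'.patch R := by
  ext p
  simp only [LabeledDelone.mem_patch]
  exact and_congr_left fun hp => LabeledDelone.mem_iff_of_patch_eq h (hp.trans_le hR)

theorem _root_.LabeledDelone.patch_translate_eq {T T' : LabeledDelone d X} {R : ℝ}
    {x : EuclideanSpace ℝ (Fin d)} (h : T.patch (‖x‖ + R) = T'.patch (‖x‖ + R)) :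
    (T.translate x).patch R = (T'.translate x).patch R := by
  ext p
  simp only [LabeledDelone.mem_patch, mem_translate]
  refine and_congr_left fun hp => LabeledDelone.mem_iff_of_patch_eq h ?_
  have := norm_add_le p.1 x
  simp only
  linarith

variable [MetricSpace X] {Ω : TilingSpace d X}

/-- The values of a strong cocycle depend on patches of a radius that is controlled uniformly. -/
theorem exists_radius_of_mem_strongCocycles {α : Ω.weakCocycles} (hα : α ∈ Ω.strongCocycles) :
    ∃ R : ℝ, 0 < R ∧ ∀ (v : EuclideanSpace ℝ (Fin d)) (T T' : Ω),
      T.1.patch (‖v‖ + R) = T'.1.patch (‖v‖ + R) → α.1 (T, v) = α.1 (T', v) := by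
  -- Baire's theorem: these sets are closed by continuity of `α` and cover the space, so one radius
  -- `n` serves a whole ball of vectors around some `v₀`.
  let A : ℕ → Set (EuclideanSpace ℝ (Fin d)) := fun n =>
    {v | ∀ T T' : Ω, T.1.patch n = T'.1.patch n → α.1 (T, v) = α.1 (T', v)}
  have hclosed : ∀ n, IsClosed (A n) := by
    intro n
    simp only [A, Set.ofPred_forall]
    exact isClosed_iInter fun T => isClosed_iInter fun T' => isClosed_iInter fun _ =>
      isClosed_eq (by fun_prop) (by fun_prop)
  have hunion : ⋃ n, A n = Set.univ := by
    refine Set.eq_univ_of_forall fun v => ?_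
    obtain ⟨R, hR⟩ := hα v
    obtain ⟨n, hn⟩ := exists_nat_ge R
    exact Set.mem_iUnion.2 ⟨n, fun T T' h => hR T T' (LabeledDelone.patch_eq_of_le h hn)⟩
  obtain ⟨n, v₀, hv₀⟩ := nonempty_interior_of_iUnion_of_closed hclosed hunion
  obtain ⟨δ, hδ, hball⟩ := Metric.mem_nhds_iff.1 (mem_interior_iff_mem_nhds.1 hv₀)
  -- The ball moves to the origin by `α(T, w) = α(T + v₀, v₀ + w) - α(T + v₀, v₀)`, at the cost of
  -- `‖v₀‖` in the radius.
  have hsmall : ∀ w : EuclideanSpace ℝ (Fin d), ‖w‖ < δ → ∀ T T' : Ω,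
      T.1.patch (‖v₀‖ + (n + 1)) = T'.1.patch (‖v₀‖ + (n + 1)) → α.1 (T, w) = α.1 (T', w) := by
    intro w hw T T' h
    have hT : ∀ T : Ω, α.1 (T, w) =
        α.1 (Ω.translate T (-v₀), v₀ + w) - α.1 (Ω.translate T (-v₀), v₀) := by
      intro T
      rw [← cocycle_translate, translate_translate, neg_add_cancel, translate_zero]
    have hp : (Ω.translate T (-v₀)).1.patch n = (Ω.translate T' (-v₀)).1.patch n := by
      refine LabeledDelone.patch_translate_eq (LabeledDelone.patch_eq_of_le h ?_)
      rw [norm_neg]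
      linarith
    rw [hT T, hT T', hball (by simpa using hw : v₀ + w ∈ Metric.ball v₀ δ) _ _ hp,
      hball (Metric.mem_ball_self hδ) _ _ hp]
  -- A long vector is covered in short steps; the radius grows only by the distance travelled.
  have key : ∀ (k : ℕ) (w : EuclideanSpace ℝ (Fin d)), ‖w‖ < δ → ∀ T T' : Ω,
      T.1.patch (k * ‖w‖ + (‖v₀‖ + (n + 1))) = T'.1.patch (k * ‖w‖ + (‖v₀‖ + (n + 1))) →
      α.1 (T, (k : ℝ) • w) = α.1 (T', (k : ℝ) • w) := by
    intro k
    induction k with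
    | zero => intro w _ T T' _; simp [cocycle_zero]
    | succ k ih =>
      intro w hw T T' h
      have hk : ((k + 1 : ℕ) : ℝ) • w = (k : ℝ) • w + w := by push_cast; rw [add_smul, one_smul]
      have h' : T.1.patch (k * ‖w‖ + (‖v₀‖ + (n + 1))) =
          T'.1.patch (k * ‖w‖ + (‖v₀‖ + (n + 1))) := by
        refine LabeledDelone.patch_eq_of_le h ?_
        push_cast
        linarith [norm_nonneg w]
      rw [hk, cocycle_add, cocycle_add, ih w hw T T' h']
      congr 1
      refine hsmall w hw _ _ (LabeledDelone.patch_translate_eq ?_)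
      rwa [norm_smul, Real.norm_of_nonneg (Nat.cast_nonneg k)]
  refine ⟨‖v₀‖ + (n + 1), by positivity, fun v T T' h => ?_⟩
  obtain ⟨k, hk⟩ := exists_nat_gt (‖v‖ / δ)
  have hk0 : (0 : ℝ) < k := lt_of_le_of_lt (by positivity) hk
  have hw : ‖(k : ℝ)⁻¹ • v‖ = ‖v‖ / k := by
    rw [norm_smul, norm_inv, Real.norm_of_nonneg hk0.le, inv_mul_eq_div]
  have h1 := key k ((k : ℝ)⁻¹ • v) (by
    rw [hw, div_lt_iff₀ hk0]
    rwa [div_lt_iff₀ hδ, mul_comm] at hk) T T'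
  rw [smul_inv_smul₀ hk0.ne', hw, mul_div_cancel₀ _ hk0.ne'] at h1
  exact h1 h

theorem IsStronglyPE.translate {s : Ω → EuclideanSpace ℝ (Fin d)} (hs : Ω.IsStronglyPE s)
    (v : EuclideanSpace ℝ (Fin d)) : Ω.IsStronglyPE fun T => s (Ω.translate T v) := by
  obtain ⟨R, hR⟩ := hs
  exact ⟨‖v‖ + R, fun T T' h => hR _ _ (LabeledDelone.patch_translate_eq h)⟩

variable [CompactSpace X]

/-- Only vectors `t z` of norm at most `|t|` contribute, so the uniform radius `R` of the strong
cocycle gives the single radius `|t| + R`. -/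
theorem isStronglyPE_primitive {φ : EuclideanSpace ℝ (Fin d) → ℝ} {κ : NNReal}
    (hφ : IsWeight φ κ) (t : ℝ) {α : Ω.weakCocycles} (hα : α ∈ Ω.strongCocycles) :
    Ω.IsStronglyPE (primitive hφ t α) := by
  obtain ⟨R, -, hR⟩ := exists_radius_of_mem_strongCocycles hα
  refine ⟨|t| + R, fun T T' h => ?_⟩
  rw [primitive_apply, primitive_apply]
  refine integral_congr_ae (Filter.Eventually.of_forall fun z => ?_)
  by_cases hz : 1 < ‖z‖
  · simp [hφ.eq_zero z hz]
  · simp only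
    rw [hR (t • z) T T' (LabeledDelone.patch_eq_of_le h ?_)]
    rw [norm_smul, Real.norm_eq_abs]
    nlinarith [abs_nonneg t, not_lt.1 hz]

theorem coboundary_mem_strongCocycles {s : C(Ω, EuclideanSpace ℝ (Fin d))}
    (hs : Ω.IsStronglyPE s) : coboundary s ∈ Ω.strongCocycles := by
  intro v
  have := (hs.translate v).add hs.neg
  simpa only [coboundary_apply, sub_eq_add_neg] using this

theorem smooth_mem_strongCocycles {φ : EuclideanSpace ℝ (Fin d) → ℝ} {κ : NNReal}
    (hφ : IsWeight φ κ) (t : ℝ) {α : Ω.weakCocycles} (hα : α ∈ Ω.strongCocycles) :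
    smooth hφ t α ∈ Ω.strongCocycles :=
  Ω.strongCocycles.add_mem hα (coboundary_mem_strongCocycles (isStronglyPE_primitive hφ t hα))

theorem mk_smooth {φ : EuclideanSpace ℝ (Fin d) → ℝ} {κ : NNReal} (hφ : IsWeight φ κ) (t : ℝ)
    (α : Ω.weakCocycles) :
    (QuotientAddGroup.mk (smooth hφ t α) : Ω.H1w) = QuotientAddGroup.mk α := by
  symm
  rw [QuotientAddGroup.eq]
  refine ⟨primitive hφ t α, fun T v => ?_⟩
  rw [smooth, neg_add_cancel_left, coboundary_apply]

theorem mk_smooth_strong {φ : EuclideanSpace ℝ (Fin d) → ℝ} {κ : NNReal} (hφ : IsWeight φ κ)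
    (t : ℝ) (α : Ω.strongCocycles) :
    (QuotientAddGroup.mk ⟨smooth hφ t α.1, smooth_mem_strongCocycles hφ t α.2⟩ : Ω.H1s) =
      QuotientAddGroup.mk α := by
  symm
  rw [QuotientAddGroup.eq]
  refine ⟨primitive hφ t α.1, isStronglyPE_primitive hφ t α.2, fun T v => ?_⟩
  change (-α.1 + (α.1 + coboundary (primitive hφ t α.1))).1 (T, v) = _
  rw [neg_add_cancel_left, coboundary_apply]

end PatternEquivariance

/-! ### Patches around points under finite local complexity -/

section FiniteLocalComplexity

variable {d : ℕ} {X : Type u} [MetricSpace X] {Ω : TilingSpace d X}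

/-- The patch of radius `R` if the origin is a point of `T`, and the empty set otherwise. -/
def pointedPatch (R : ℝ) (T : Ω) : Set (EuclideanSpace ℝ (Fin d) × X) :=
  {p ∈ T.1.patch R | 0 ∈ T.1.points}

theorem pointedPatch_eq_patch {R : ℝ} {T : Ω} (hT : 0 ∈ T.1.points) :
    pointedPatch R T = T.1.patch R :=
  Set.ext fun _ => and_iff_left hT

theorem mem_points_iff_of_patch_eq {R : ℝ} {T T' : Ω} (h : T.1.patch R = T'.1.patch R)
    {x : EuclideanSpace ℝ (Fin d)} (hx : ‖x‖ < R) : x ∈ T.1.points ↔ x ∈ T'.1.points := by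
  simp only [mem_points]
  exact exists_congr fun l => LabeledDelone.mem_iff_of_patch_eq h hx

theorem pointedPatch_congr {R : ℝ} (hR : 0 < R) {T T' : Ω} (h : T.1.patch R = T'.1.patch R) :
    pointedPatch R T = pointedPatch R T' := by
  ext p
  simp only [pointedPatch, h, mem_points_iff_of_patch_eq h (norm_zero.trans_lt hR)]

variable [CompactSpace X]

theorem _root_.LabeledDelone.finite_patch (T : LabeledDelone d X) (R : ℝ) :
    (T.patch R).Finite := by
  refine (T.finite_inter ((isCompact_closedBall (0 : EuclideanSpace ℝ (Fin d)) R).prod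
    (isCompact_univ (X := X)))).subset fun p hp => ⟨hp.1, ?_, trivial⟩
  exact mem_closedBall_zero_iff.2 hp.2.le

/-- In the presence of finite local complexity, there are finitely many patches of a given radius
around points of the tilings. -/
theorem IsFLC.finite_range_pointedPatch (hΩ : Ω.IsFLC) (R : ℝ) :
    (Set.range (pointedPatch (Ω := Ω) R)).Finite := by
  obtain ⟨F, hF, hFΩ⟩ := hΩ R
  -- A patch with a point at the origin is a representative `P` recentered at one of its own points,
  -- so a finite `P` leaves finitely many translations. The empty set accounts for tilings without a
  -- point at the origin.
  have hfin : ((⋃ P ∈ {P ∈ F | P.Finite}, (fun w : EuclideanSpace ℝ (Fin d) × X =>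
      (fun p : EuclideanSpace ℝ (Fin d) × X => (p.1 + -w.1, p.2)) '' P) '' P) ∪ {∅}).Finite :=
    ((hF.subset fun _ h => h.1).biUnion fun P hP => hP.2.image _).union (Set.finite_singleton _)
  refine hfin.subset ?_
  rintro _ ⟨T, rfl⟩
  by_cases h : (pointedPatch R T).Nonempty
  · left
    obtain ⟨q, hq, hT⟩ := h
    obtain ⟨P, hP, v, hv⟩ := hFΩ T
    have hR : 0 < R := (norm_nonneg _).trans_lt hq.2
    obtain ⟨l, hl⟩ := mem_points.1 hT
    have h0 : ((0 : EuclideanSpace ℝ (Fin d)), l) ∈ T.1.patch R := ⟨hl, by simpa using hR⟩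
    have hPfin : P.Finite := by
      refine Set.Finite.of_finite_image (hv ▸ T.1.finite_patch R) fun a _ b _ hab => ?_
      rw [Prod.ext_iff] at hab ⊢
      exact ⟨add_right_cancel hab.1, hab.2⟩
    rw [hv] at h0
    obtain ⟨w, hw, hw0⟩ := h0
    have hwv : v = -w.1 := (neg_eq_of_add_eq_zero_right (Prod.ext_iff.1 hw0).1).symm
    refine Set.mem_iUnion₂.2 ⟨P, ⟨hP, hPfin⟩, w, hw, ?_⟩
    rw [pointedPatch_eq_patch hT, hv, hwv]
  · right
    exact Set.not_nonempty_iff_eq_empty.1 h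

/-- In the presence of finite local complexity, the patch around a point is locally constant. -/
theorem IsFLC.eventually_pointedPatch_eq (hΩ : Ω.IsFLC) (R : ℝ) {T₀ : Ω}
    (hT₀ : 0 ∈ T₀.1.points) :
    ∀ᶠ T in 𝓝[{T : Ω | 0 ∈ T.1.points}] T₀, pointedPatch R T = pointedPatch R T₀ := by
  -- All labeled points that can occur in a pointed patch form a finite set, so within it a point
  -- close to `p` equals `p`, and local constancy is checked one point at a time.
  set D : Set (EuclideanSpace ℝ (Fin d) × X) := ⋃₀ Set.range (pointedPatch (Ω := Ω) R) with hD
  have hDfin : D.Finite := by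
    refine (hΩ.finite_range_pointedPatch R).sUnion ?_
    rintro _ ⟨T, rfl⟩
    exact (T.1.finite_patch R).subset fun p hp => hp.1
  have hmem : ∀ {T : Ω}, 0 ∈ T.1.points → ∀ p ∈ T.1.carrier, ‖p.1‖ < R → p ∈ D :=
    fun {T} hT p hp hpR => ⟨_, ⟨T, rfl⟩, ⟨hp, hpR⟩, hT⟩
  have hval : Filter.Tendsto (Subtype.val : Ω → LabeledDelone d X)
      (𝓝[{T : Ω | 0 ∈ T.1.points}] T₀) (𝓝 T₀.1) :=
    (continuous_subtype_val.tendsto T₀).mono_left nhdsWithin_le_nhds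
  have key : ∀ p ∈ D, ∀ᶠ T in 𝓝[{T : Ω | 0 ∈ T.1.points}] T₀,
      p ∈ T.1.carrier ↔ p ∈ T₀.1.carrier := by
    intro p hp
    by_cases hpT : p ∈ T₀.1.carrier
    · have hpR : ‖p.1‖ < R := by
        obtain ⟨_, ⟨T, rfl⟩, hpT⟩ := hp
        exact hpT.1.2
      have hnhds : (D \ {p})ᶜ ∩ {q | ‖q.1‖ < R} ∈ 𝓝 p :=
        Filter.inter_mem ((hDfin.subset Set.sdiff_subset).isClosed.isOpen_compl.mem_nhds
          fun h => h.2 rfl) ((isOpen_lt (by fun_prop) continuous_const).mem_nhds hpR)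
      obtain ⟨δ, hδ, hball⟩ := Metric.mem_nhds_iff.1 hnhds
      filter_upwards [LabeledDelone.eventually_exists_dist_lt hval hpT hδ,
        self_mem_nhdsWithin] with T ⟨q, hq, hqp⟩ hT
      have h := hball (Metric.mem_ball.2 hqp)
      have hqD := hmem hT q hq h.2
      have hqp : q = p := by
        by_contra hne
        exact h.1 ⟨hqD, hne⟩
      exact ⟨fun _ => hpT, fun _ => hqp ▸ hq⟩
    · by_contra hcon
      have hfreq : ∃ᶠ T in 𝓝[{T : Ω | 0 ∈ T.1.points}] T₀, T ∈ {T : Ω | p ∈ T.1.carrier} :=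
        (Filter.not_eventually.1 hcon).mono fun T hT => by
          by_contra h
          exact hT ⟨fun h' => absurd h' h, fun h' => absurd h' hpT⟩
      have := Filter.frequently_mem_iff_neBot.1 hfreq
      refine hpT (LabeledDelone.mem_carrier_of_tendsto (hval.mono_left
        (inf_le_left (b := Filter.principal {T : Ω | p ∈ T.1.carrier})))
        (g := fun _ => p) ?_ tendsto_const_nhds)
      exact Filter.mem_inf_of_right (Filter.mem_principal_self _)
  filter_upwards [(Set.Finite.eventually_all hDfin).2 key, self_mem_nhdsWithin] with T hT hT0
  rw [pointedPatch_eq_patch hT0, pointedPatch_eq_patch hT₀]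
  ext p
  exact ⟨fun hp => ⟨(hT p (hmem hT0 p hp.1 hp.2)).1 hp.1, hp.2⟩,
    fun hp => ⟨(hT p (hmem hT₀ p hp.1 hp.2)).2 hp.1, hp.2⟩⟩

end FiniteLocalComplexity

end TilingSpace

/-! ### Patch labels: injectivity and finite local complexity of the deformation -/

namespace TilingSpace

open LabeledDelone (mem_points mem_translate)

variable {d : ℕ} {X : Type u} [MetricSpace X] {Ω : TilingSpace d X}
  {α : Ω.weakCocycles} {K M : ℝ}

variable (Ω) in
/-- Labels recording the patches of radius `ρ` around points. -/
def patchLabel (ρ : ℝ) : Ω → Set.range (pointedPatch (Ω := Ω) ρ) :=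
  Set.rangeFactorization (pointedPatch ρ)

theorem patch_eq_of_patchLabel_eq {ρ : ℝ} {T T' : Ω} (hT : 0 ∈ T.1.points)
    (hT' : 0 ∈ T'.1.points) (h : patchLabel Ω ρ T = patchLabel Ω ρ T') :
    T.1.patch ρ = T'.1.patch ρ := by
  rw [← pointedPatch_eq_patch hT, ← pointedPatch_eq_patch hT']
  exact congrArg Subtype.val h

theorem patchLabel_congr {ρ : ℝ} (hρ : 0 < ρ) {T T' : Ω} (h : T.1.patch ρ = T'.1.patch ρ) :
    patchLabel Ω ρ T = patchLabel Ω ρ T' :=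
  Subtype.ext (pointedPatch_congr hρ h)

theorem zero_mem_points_translate {T : Ω} {x : EuclideanSpace ℝ (Fin d)} :
    0 ∈ (Ω.translate T x).1.points ↔ x ∈ T.1.points := by
  rw [mem_points_translate, zero_add]

/-- If two tilings have the same deformation and agree on a large ball, they agree on a slightly
larger ball. -/
theorem patch_add_one_subset_of_deform_eq (hα : IsBiLipschitz α K M) {R₀ R ρ r : ℝ}
    (hR₀ : 0 < R₀) (hα' : ∀ (v : EuclideanSpace ℝ (Fin d)) (T T' : Ω),
      T.1.patch (‖v‖ + R₀) = T'.1.patch (‖v‖ + R₀) → α.1 (T, v) = α.1 (T', v))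
    (hR : 0 < R) (hΩR : ∀ (T : Ω) (x : EuclideanSpace ℝ (Fin d)),
      ∃ p ∈ T.1.carrier, dist p.1 x ≤ R) (hρ : 2 * R + R₀ + 1 < ρ) (hr : ρ ≤ r) {S S' : Ω}
    (hS : deform hα (patchLabel Ω ρ) S = deform hα (patchLabel Ω ρ) S')
    (h : S.1.patch r = S'.1.patch r) : S.1.patch (r + 1) ⊆ S'.1.patch (r + 1) := by
  rintro ⟨x, l⟩ ⟨hx, hxr⟩
  refine ⟨?_, hxr⟩
  simp only at hxr
  by_cases hxr' : ‖x‖ < r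
  · exact (LabeledDelone.mem_iff_of_patch_eq (p := (x, l)) h hxr').1 hx
  rw [not_lt] at hxr'
  have hx0 : 0 < ‖x‖ := by linarith
  -- A point `y` of `S` is sought within `R` of the place at distance `a` before `x` on the segment
  -- from the origin. Then `‖y‖ + R₀ < r`, so `α(·, y)` agrees on `S` and `S'`, and `dist y x ≤ 2 R
  -- + R₀ + 1 < ρ`, so the label of `y` sees `x`.
  set a := R + R₀ + 1 with ha
  have hax : a ≤ ‖x‖ := by linarith
  obtain ⟨⟨y, l'⟩, hy, hyR⟩ := hΩR S ((1 - a / ‖x‖) • x)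
  simp only at hyR
  have hc : ‖(1 - a / ‖x‖) • x‖ = ‖x‖ - a := by
    rw [norm_smul, Real.norm_of_nonneg (sub_nonneg.2 ((div_le_one hx0).2 hax)), sub_mul, one_mul,
      div_mul_cancel₀ _ hx0.ne']
  have hcx : dist ((1 - a / ‖x‖) • x) x = a := by
    rw [dist_eq_norm, sub_smul, one_smul, sub_sub_cancel_left, norm_neg, norm_smul, norm_div,
      norm_norm, div_mul_cancel₀ _ hx0.ne', Real.norm_of_nonneg (by positivity)]
  have hynorm : ‖y‖ ≤ ‖x‖ - a + R := by
    have := norm_le_norm_add_norm_sub' y ((1 - a / ‖x‖) • x)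
    rw [← dist_eq_norm] at this
    linarith
  have hyx : dist y x ≤ a + R := by
    linarith [dist_triangle y ((1 - a / ‖x‖) • x) x]
  have hαy : α.1 (S, y) = α.1 (S', y) :=
    hα' y S S' (LabeledDelone.patch_eq_of_le h (by linarith))
  have hyS : y ∈ S.1.points := mem_points.2 ⟨l', hy⟩
  -- The matching point of `S'` is `y` itself, by injectivity of `α(S', ·)`; its label therefore
  -- transfers the patch around `y`.
  obtain ⟨y', hy', hα'y, hL⟩ := exists_of_deform_eq hS hyS
  have hyy : y' = y := hα.injective S' (hα'y.trans hαy)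
  subst hyy
  have hp := patch_eq_of_patchLabel_eq (zero_mem_points_translate.2 hyS)
    (zero_mem_points_translate.2 hy') hL.symm
  have hmem : (x - y', l) ∈ (Ω.translate S y').1.carrier := mem_translate.2 (by simpa using hx)
  rw [LabeledDelone.mem_iff_of_patch_eq (p := (x - y', l)) hp (by
    simp only
    rw [← dist_eq_norm, dist_comm]
    linarith)] at hmem
  simpa using mem_translate.1 hmem

/-- Labeling by large patches makes the deformation by a strong cocycle injective. -/
theorem injective_deform_patchLabel (hα : IsBiLipschitz α K M) {R₀ R ρ : ℝ}
    (hR₀ : 0 < R₀) (hα' : ∀ (v : EuclideanSpace ℝ (Fin d)) (T T' : Ω),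
      T.1.patch (‖v‖ + R₀) = T'.1.patch (‖v‖ + R₀) → α.1 (T, v) = α.1 (T', v))
    (hR : 0 < R) (hΩR : ∀ (T : Ω) (x : EuclideanSpace ℝ (Fin d)),
      ∃ p ∈ T.1.carrier, dist p.1 x ≤ R) (hρ : 2 * R + R₀ + 1 < ρ) :
    Function.Injective (deform hα (patchLabel Ω ρ)) := by
  intro T T' h
  obtain ⟨p, hp⟩ := T.1.nonempty_carrier
  have hpT : p.1 ∈ T.1.points := ⟨p, hp, rfl⟩
  obtain ⟨y, hy, hyα, hyL⟩ := exists_of_deform_eq h hpT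
  refine hα.eq_of_translate_eq (x := p.1) (y := y) ?_ hyα.symm
  -- With the matched points at the origin, the common label gives agreement up to radius `ρ`, and
  -- the deformations remain equal; this starts the induction on the radius.
  set S := Ω.translate T p.1 with hS
  set S' := Ω.translate T' y with hS'
  have hdef : deform hα (patchLabel Ω ρ) S = deform hα (patchLabel Ω ρ) S' := by
    rw [hS, hS', deform_translate, deform_translate, h, hyα]
  have hpatch : ∀ n : ℕ, S.1.patch (ρ + n) = S'.1.patch (ρ + n) := by
    intro n
    induction n with
    | zero =>
      rw [Nat.cast_zero, add_zero]
      exact patch_eq_of_patchLabel_eq (zero_mem_points_translate.2 hpT)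
        (zero_mem_points_translate.2 hy) hyL.symm
    | succ n ih =>
      have hn : ρ ≤ ρ + n := le_add_of_nonneg_right (Nat.cast_nonneg n)
      push_cast
      rw [← add_assoc]
      exact (patch_add_one_subset_of_deform_eq hα hR₀ hα' hR hΩR hρ hn hdef ih).antisymm
        (patch_add_one_subset_of_deform_eq hα hR₀ hα' hR hΩR hρ hn hdef.symm ih.symm)
  refine Subtype.ext (LabeledDelone.ext (Set.ext fun q => ?_))
  obtain ⟨n, hn⟩ := exists_nat_gt ‖q.1‖
  exact LabeledDelone.mem_iff_of_patch_eq (hpatch n) (by linarith)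

variable [CompactSpace X]

/-- Deforming by a strong cocycle, with patches as labels, preserves finite local complexity. -/
theorem IsFLC.of_deform_patchLabel (hΩ : Ω.IsFLC) (hα : IsBiLipschitz α K M) {R₀ R ρ : ℝ}
    (hR₀ : 0 < R₀) (hα' : ∀ (v : EuclideanSpace ℝ (Fin d)) (T T' : Ω),
      T.1.patch (‖v‖ + R₀) = T'.1.patch (‖v‖ + R₀) → α.1 (T, v) = α.1 (T', v))
    (hΩR : ∀ (T : Ω) (x : EuclideanSpace ℝ (Fin d)),
      ∃ p ∈ T.1.carrier, dist p.1 x ≤ R) (hρ : 0 < ρ)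
    [MetricSpace (Set.range (pointedPatch (Ω := Ω) ρ))]
    {Ω' : TilingSpace d (Set.range (pointedPatch (Ω := Ω) ρ))}
    (hΩ' : ∀ S : Ω', ∃ T, S.1 = deform hα (patchLabel Ω ρ) T) : Ω'.IsFLC := by
  intro R'
  -- The deformed patch will be recentered at the image of a point within `R` of the origin, so its
  -- points have preimages within `B` of that point. The patch of radius `r` around it determines
  -- both their images (`B + R₀`) and their labels (`B + ρ`).
  set B := K * (R' + M * R) with hB
  set r := B + R₀ + ρ with hr
  have hfin := hΩ.finite_range_pointedPatch r
  choose rep hrep using fun Q : Set.range (pointedPatch (Ω := Ω) r) => Q.2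
  let W : Set (EuclideanSpace ℝ (Fin d) × Set.range (pointedPatch (Ω := Ω) ρ)) :=
    ⋃ Q : Set.range (pointedPatch (Ω := Ω) r),
      (fun p : EuclideanSpace ℝ (Fin d) × X =>
        (α.1 (rep Q, p.1), patchLabel Ω ρ (Ω.translate (rep Q) p.1))) '' Q.1
  have hW : W.Finite := by
    have := hfin.to_subtype
    refine Set.finite_iUnion fun Q => Set.Finite.image _ ?_
    rw [← hrep Q]
    exact ((rep Q).1.finite_patch r).subset fun p hp => hp.1
  have hWmem : ∀ (S : Ω) (u : EuclideanSpace ℝ (Fin d)), 0 ∈ S.1.points → u ∈ S.1.points →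
      ‖u‖ ≤ B → (α.1 (S, u), patchLabel Ω ρ (Ω.translate S u)) ∈ W := by
    intro S u hS hu huB
    obtain ⟨l, hl⟩ := mem_points.1 hu
    have hul : (u, l) ∈ pointedPatch r S := ⟨⟨hl, by simp only; linarith⟩, hS⟩
    refine Set.mem_iUnion.2 ⟨⟨_, S, rfl⟩, (u, l), hul, ?_⟩
    set S₀ := rep ⟨_, S, rfl⟩ with hS₀
    have hSS : pointedPatch r S₀ = pointedPatch r S := hrep ⟨_, S, rfl⟩
    have hS₀' : 0 ∈ S₀.1.points := (hSS.superset hul).2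
    rw [pointedPatch_eq_patch hS, pointedPatch_eq_patch hS₀'] at hSS
    have h1 : α.1 (S₀, u) = α.1 (S, u) :=
      hα' u _ _ (LabeledDelone.patch_eq_of_le hSS (by linarith))
    have h2 : patchLabel Ω ρ (Ω.translate S₀ u) = patchLabel Ω ρ (Ω.translate S u) :=
      patchLabel_congr hρ (LabeledDelone.patch_translate_eq
        (LabeledDelone.patch_eq_of_le hSS (by linarith)))
    exact Prod.ext h1 h2
  -- Each recentered patch is a subset of the finite set `W`, so the subsets of `W` represent all
  -- patches.
  refine ⟨{P | P ⊆ W}, hW.finite_subsets, fun S => ?_⟩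
  obtain ⟨T, hT⟩ := hΩ' S
  obtain ⟨p, hp, hpR⟩ := hΩR T 0
  rw [dist_zero_right] at hpR
  have hpT : p.1 ∈ T.1.points := ⟨p, hp, rfl⟩
  have hw : ‖α.1 (T, p.1)‖ ≤ M * R :=
    (hα.norm_apply_le T p.1).trans (mul_le_mul_of_nonneg_left hpR hα.pos_right.le)
  refine ⟨{q | (q.1 + α.1 (T, p.1), q.2) ∈ S.1.patch R'}, ?_, α.1 (T, p.1), ?_⟩
  · rintro q ⟨hq, hqR⟩
    rw [hT, mem_deform] at hq
    obtain ⟨x, hx, hxq⟩ := hq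
    rw [Prod.ext_iff] at hxq
    simp only at hxq hqR
    have h1 : q.1 = α.1 (Ω.translate T p.1, x - p.1) := by
      rw [cocycle_sub, hxq.1, add_sub_cancel_right]
    have h2 : q.2 = patchLabel Ω ρ (Ω.translate (Ω.translate T p.1) (x - p.1)) := by
      rw [translate_translate, add_sub_cancel, hxq.2]
    have h3 : q = (α.1 (Ω.translate T p.1, x - p.1),
        patchLabel Ω ρ (Ω.translate (Ω.translate T p.1) (x - p.1))) := Prod.ext h1 h2
    rw [h3]
    refine hWmem _ _ (zero_mem_points_translate.2 hpT)
      (mem_points_translate.2 (by simpa using hx)) ?_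
    refine (hα.norm_le (Ω.translate T p.1) _).trans
      (mul_le_mul_of_nonneg_left ?_ hα.pos_left.le)
    rw [← h1]
    have := norm_sub_le (q.1 + α.1 (T, p.1)) (α.1 (T, p.1))
    rw [add_sub_cancel_right] at this
    linarith
  · ext q
    constructor
    · intro hq
      exact ⟨(q.1 - α.1 (T, p.1), q.2), by simpa using hq, by simp⟩
    · rintro ⟨q', hq', rfl⟩
      exact hq'

/-- A bi-Lipschitz strong cocycle on a tiling space with finite local complexity induces a shape
deformation to such a tiling space. -/
theorem IsFLC.exists_homeomorph_deform (hΩ : Ω.IsFLC) (hα : IsBiLipschitz α K M)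
    (hαs : α ∈ Ω.strongCocycles) :
    ∃ (Y : Type u) (_ : MetricSpace Y) (_ : CompactSpace Y) (Ω' : TilingSpace d Y) (h : Ω ≃ₜ Ω'),
      IsShapeDeformation Ω Ω' α h ∧ (Ω.IsAperiodic → Ω'.IsAperiodic) ∧ Ω'.IsFLC := by
  obtain ⟨R₀, hR₀, hα'⟩ := exists_radius_of_mem_strongCocycles hαs
  obtain ⟨_, R, -, hR, hΩR⟩ := Ω.exists_uniform
  set ρ := 2 * R + R₀ + 2 with hρ
  have hfin : Finite (Set.range (pointedPatch (Ω := Ω) ρ)) :=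
    (hΩ.finite_range_pointedPatch ρ).to_subtype
  -- Any metric on the finite label set will do: compactness is automatic, and the label is locally
  -- constant on tilings with a point at the origin.
  let _ : MetricSpace (Set.range (pointedPatch (Ω := Ω) ρ)) :=
    MetricSpace.induced (fun Q => ((Finite.equivFin _ Q : ℕ) : ℝ))
      (Nat.cast_injective.comp (Fin.val_injective.comp (Equiv.injective _))) inferInstance
  have hinj := injective_deform_patchLabel hα hR₀ hα' hR (fun T => (hΩR T).2)
    (ρ := ρ) (by linarith)
  have hL : ContinuousOn (patchLabel Ω ρ) {T | 0 ∈ T.1.points} := by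
    intro T hT
    refine tendsto_const_nhds.congr' ?_
    filter_upwards [hΩ.eventually_pointedPatch_eq ρ hT] with T' hT'
    exact Subtype.ext hT'.symm
  obtain ⟨Ω', h, hdef, hshape, hap⟩ := TilingSpace.exists_homeomorph_deform hα hL hinj
  refine ⟨_, _, inferInstance, Ω', h, hshape, hap, ?_⟩
  refine hΩ.of_deform_patchLabel hα hR₀ hα' (fun T => (hΩR T).2) (by positivity) fun S => ?_
  obtain ⟨T, rfl⟩ := h.surjective S
  exact ⟨T, hdef T⟩

/-- A bi-Lipschitz cocycle induces a shape deformation. -/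
theorem IsBiLipschitz.exists_homeomorph_deform (hα : IsBiLipschitz α K M) :
    ∃ (Y : Type u) (_ : MetricSpace Y) (_ : CompactSpace Y) (Ω' : TilingSpace d Y) (h : Ω ≃ₜ Ω'),
      IsShapeDeformation Ω Ω' α h ∧ (Ω.IsAperiodic → Ω'.IsAperiodic) := by
  let _ : MetricSpace Ω := TopologicalSpace.metrizableSpaceMetric Ω
  obtain ⟨Ω', h, -, hshape, hap⟩ := TilingSpace.exists_homeomorph_deform hα (L := id)
    continuousOn_id (injective_deform_of_injective hα Function.injective_id)
  exact ⟨Ω, inferInstance, inferInstance, Ω', h, hshape, hap⟩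

end TilingSpace

/-! ### The shape deformations realizing a class -/

theorem mainTheorem2 {d : ℕ} {X : Type u} [MetricSpace X] [CompactSpace X]
    (Ω : TilingSpace d X) (hΩ : Ω.IsUniquelyErgodic) (μ : Ω.InvariantMeasure) :
    (∀ c : Ω.H1w, IsUnit (Ω.ruelleSullivan μ c) →
      ∃ α₀ : Ω.weakCocycles, (QuotientAddGroup.mk α₀ : Ω.H1w) = c ∧
        ∃ (Y : Type u) (_ : MetricSpace Y) (_ : CompactSpace Y) (Ω' : TilingSpace d Y)
          (h : Ω ≃ₜ Ω'),
          IsShapeDeformation Ω Ω' α₀ h ∧ (Ω.IsAperiodic → Ω'.IsAperiodic)) ∧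
    (Ω.IsFLC → ∀ c : Ω.H1s, IsUnit (Ω.ruelleSullivan μ (Ω.strongToWeak c)) →
      ∃ α₀ : Ω.strongCocycles, (QuotientAddGroup.mk α₀ : Ω.H1s) = c ∧
        ∃ (Y : Type u) (_ : MetricSpace Y) (_ : CompactSpace Y) (Ω' : TilingSpace d Y)
          (h : Ω ≃ₜ Ω'),
          IsShapeDeformation Ω Ω' α₀.1 h ∧ (Ω.IsAperiodic → Ω'.IsAperiodic) ∧ Ω'.IsFLC) := by
  obtain ⟨φ, κ, hφ⟩ := exists_isWeight d
  constructor
  · intro c hc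
    obtain ⟨α, rfl⟩ := QuotientAddGroup.mk_surjective c
    obtain ⟨n, K, M, hα⟩ := hΩ.exists_isBiLipschitz_smooth μ hφ α hc
    exact ⟨_, (TilingSpace.mk_smooth hφ 1 _).trans (TilingSpace.mk_smooth hφ n α),
      hα.exists_homeomorph_deform⟩
  · intro hflc c hc
    obtain ⟨α, rfl⟩ := QuotientAddGroup.mk_surjective c
    obtain ⟨n, K, M, hα⟩ := hΩ.exists_isBiLipschitz_smooth μ hφ α.1 hc
    have hs := TilingSpace.smooth_mem_strongCocycles hφ n α.2
    exact ⟨⟨_, TilingSpace.smooth_mem_strongCocycles hφ 1 hs⟩,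
      (TilingSpace.mk_smooth_strong hφ 1 ⟨_, hs⟩).trans (TilingSpace.mk_smooth_strong hφ n α),
      hflc.exists_homeomorph_deform hα (TilingSpace.smooth_mem_strongCocycles hφ 1 hs)⟩
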